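/- Let $L^2=L^2(\mathbb{R}^3;\mathbb{C})$ and let $H_0=-\tfrac12\Delta$ be the self-adjoint operator on $L^2$ with domain $H^2(\mathbb{R}^3)$; its square root $H_0^{1/2}$ has domain $H^1(\mathbb{R}^3)$ and symbol $|\xi|/\sqrt2$ in Fourier space. A bounded operator $T$ on $L^2$ is trace class if $\|T\|_1:=\operatorname{Tr}|T|<\infty$. Let $Z$ be the set of all Hermitian trace class operators $\rho$ on $L^2$ such that $H_0^{1/2}\rho H_0^{1/2}$ is defined on all of $H^1(\mathbb{R}^3)$ and its closure $\overline{H_0^{1/2}\rho H_0^{1/2}}$ is a trace class operator on $L^2$, with $$\|\rho\|_Z:=\|\rho\|_1+\big\|\overline{H_0^{1/2}\rho H_0^{1/2}}\big\|_1 .$$ Let $Y$ be the set of all Hermitian trace class operators $\rho$ on $L^2$ such that $H_0\rho$ is (defined on all of $L^2$ and) trace class, with $$\|\rho\|_Y:=\|\rho\|_1+\|H_0\rho\|_1 .$$ Then: (a) $(Z,\|\cdot\|_Z)$ is a real Banach space. (b) $(Y,\|\cdot\|_Y)$ is a real Banach space. (c) $Y$ is a dense subspace of $Z$: $Y$ is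 a linear subspace of $Z$, and it is dense in $Z$ with respect to $\|\cdot\|_Z$. -/

import Mathlib

noncomputable section

namespace HartreeFock

open MeasureTheory FourierTransform TemperedDistribution Laplacian
open scoped ENNReal SchwartzMap

/-! ### Trace class operators -/

section TraceClass

variable {H : Type*} [NormedAddCommGroup H] [InnerProductSpace ℂ H] [CompleteSpace H]

/-- Trace of a positive bounded operator, as a value in `[0, ∞]`: the sum of the diagonal matrix
elements in a Hilbert basis (for a positive operator the choice of the basis is irrelevant). -/
def posTrace (T : H →L[ℂ] H) : ℝ≥0∞ :=
  ∑' i, ENNReal.ofReal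
    (RCLike.re (inner ℂ ((exists_hilbertBasis ℂ H).choose_spec.choose i)
      (T ((exists_hilbertBasis ℂ H).choose_spec.choose i))))

/-- `Tr |T|`, where `|T| = (T* T)^{1/2}`. -/
def traceNorm (T : H →L[ℂ] H) : ℝ≥0∞ := posTrace (CFC.abs T)

/-- The trace norm of a possibly unbounded operator `T`: it is the trace norm of `γ` if `T` is the
everywhere defined bounded operator `γ`, and `∞` if `T` is not of this form. -/
def pTraceNorm (T : H →ₗ.[ℂ] H) : ℝ≥0∞ :=
  ⨅ (γ : H →L[ℂ] H) (_ : T = (γ : H →ₗ[ℂ] H).toPMap ⊤), traceNorm γ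

/-- The product `S T` of unbounded operators on its natural domain `{x ∈ D(T) | T x ∈ D(S)}`. -/
def pcomp (S T : H →ₗ.[ℂ] H) : H →ₗ.[ℂ] H :=
  S.comp (T.domRestrict ((S.domain.comap T.toFun).map T.domain.subtype)) (by
    rintro ⟨x, hx, hx'⟩
    obtain ⟨y, hy, rfl⟩ := hx
    exact hy)

end TraceClass

/-! ### The free Hamiltonian on `L²(ℝ³)` -/

/-- The Hilbert space `L²(ℝ³; ℂ)`. -/
abbrev L2 : Type := Lp (α := EuclideanSpace ℝ (Fin 3)) ℂ 2 volume

/-- The pairs `(f, g)` in `L² × L²` with `g = -Δ f / 2` in the sense of tempered distributions. -/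
def freeHamiltonianGraph : Submodule ℂ (L2 × L2) where
  carrier := {p | (p.2 : 𝓢'(EuclideanSpace ℝ (Fin 3), ℂ)) =
    (-(1 / 2) : ℂ) • Δ (p.1 : 𝓢'(EuclideanSpace ℝ (Fin 3), ℂ))}
  zero_mem' := by
    simp [← Lp.toTemperedDistributionCLM_apply, ← laplacianCLM_apply]
  add_mem' {p q} hp hq := by
    simp only [Set.mem_ofPred_eq, ← Lp.toTemperedDistributionCLM_apply,
      ← laplacianCLM_apply] at hp hq ⊢
    simp only [Prod.fst_add, Prod.snd_add, map_add, smul_add, hp, hq]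
  smul_mem' c p hp := by
    simp only [Set.mem_ofPred_eq, ← Lp.toTemperedDistributionCLM_apply,
      ← laplacianCLM_apply] at hp ⊢
    simp only [Prod.smul_fst, Prod.smul_snd, map_smul, hp]
    rw [smul_comm]

/-- `H₀ = -Δ/2` on its maximal domain `{f ∈ L² | Δ f ∈ L²} = H²(ℝ³)`. -/
def freeHamiltonian : L2 →ₗ.[ℂ] L2 := freeHamiltonianGraph.toLinearPMap

theorem graph_freeHamiltonian : freeHamiltonian.graph = freeHamiltonianGraph := by
  refine Submodule.toLinearPMap_graph_eq _ ?_
  rintro ⟨f, g⟩ hx (rfl : f = 0)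
  have hx' : Lp.toTemperedDistributionCLM ℂ volume 2 g = 0 := by
    have h : (g : 𝓢'(EuclideanSpace ℝ (Fin 3), ℂ)) =
      (-(1 / 2) : ℂ) • Δ ((0 : L2) : 𝓢'(EuclideanSpace ℝ (Fin 3), ℂ)) := hx
    simpa [← Lp.toTemperedDistributionCLM_apply, ← laplacianCLM_apply] using h
  have h := LinearMap.mem_ker.2 hx'
  rwa [Lp.ker_toTemperedDistributionCLM_eq_bot, Submodule.mem_bot] at h

/-- The pairs `(f, g)` in `L² × L²` with `𝓕 g (ξ) = (|ξ|/√2) 𝓕 f (ξ)`. Since Mathlib normalizes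
`𝓕` with `exp (-2πi⟨x, ξ⟩)`, the symbol `|ξ|/√2` reads `2π|ξ|/√2` here. -/
def sqrtFreeHamiltonianGraph : Submodule ℂ (L2 × L2) where
  carrier := {p | ∀ᵐ ξ, (𝓕 p.2 : L2) ξ =
    ((2 * Real.pi * ‖ξ‖ / Real.sqrt 2 : ℝ) : ℂ) * (𝓕 p.1 : L2) ξ}
  zero_mem' := by
    have h : (𝓕 (0 : L2) : L2) = 0 := map_zero (Lp.fourierTransformₗᵢ _ _)
    simp only [Set.mem_ofPred_eq, Prod.fst_zero, Prod.snd_zero, h]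
    filter_upwards with ξ
    simp
  add_mem' {p q} hp hq := by
    simp only [Set.mem_ofPred_eq, Prod.fst_add, Prod.snd_add, FourierTransform.fourier_add] at hp hq ⊢
    filter_upwards [hp, hq, Lp.coeFn_add (𝓕 p.1 : L2) (𝓕 q.1), Lp.coeFn_add (𝓕 p.2 : L2) (𝓕 q.2)]
      with ξ h1 h2 h3 h4
    rw [h3, h4, Pi.add_apply, Pi.add_apply, h1, h2, mul_add]
  smul_mem' c p hp := by
    simp only [Set.mem_ofPred_eq, Prod.smul_fst, Prod.smul_snd, FourierTransform.fourier_smul] at hp ⊢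
    filter_upwards [hp, Lp.coeFn_smul c (𝓕 p.1 : L2), Lp.coeFn_smul c (𝓕 p.2 : L2)]
      with ξ h1 h3 h4
    rw [h3, h4, Pi.smul_apply, Pi.smul_apply, h1, smul_eq_mul, smul_eq_mul, mul_left_comm]

/-- `H₀^{1/2}`, the operator with the symbol `|ξ|/√2`, on its maximal domain `H¹(ℝ³)`. -/
def sqrtFreeHamiltonian : L2 →ₗ.[ℂ] L2 := sqrtFreeHamiltonianGraph.toLinearPMap

theorem graph_sqrtFreeHamiltonian : sqrtFreeHamiltonian.graph = sqrtFreeHamiltonianGraph := by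
  refine Submodule.toLinearPMap_graph_eq _ ?_
  rintro ⟨f, g⟩ hx (rfl : f = 0)
  have h0 : (𝓕 (0 : L2) : L2) = 0 := map_zero (Lp.fourierTransformₗᵢ _ _)
  have hx' : ∀ᵐ ξ, (𝓕 g : L2) ξ =
    ((2 * Real.pi * ‖ξ‖ / Real.sqrt 2 : ℝ) : ℂ) * (𝓕 (0 : L2) : L2) ξ := hx
  rw [h0] at hx'
  have h1 : (𝓕 g : L2) = 0 := by
    refine Lp.ext ?_
    filter_upwards [hx', Lp.coeFn_zero ℂ 2 (volume : Measure (EuclideanSpace ℝ (Fin 3)))]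
      with ξ h2 h3
    rw [h2, h3]
    simp
  have h4 := Lp.norm_fourier_eq g
  rw [h1, norm_zero] at h4
  exact norm_eq_zero.1 h4.symm

/-- `H₀` has the symbol `|ξ|²/2` (with `ξ` replaced by `2πξ`, as above). -/
theorem mem_freeHamiltonianGraph_iff (f g : L2) : (f, g) ∈ freeHamiltonianGraph ↔
    ∀ᵐ ξ, (𝓕 g : L2) ξ = (((2 * Real.pi * ‖ξ‖) ^ 2 / 2 : ℝ) : ℂ) * (𝓕 f : L2) ξ := by
  have e1 : (f, g) ∈ freeHamiltonianGraph ↔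
      ((𝓕 g : L2) : 𝓢'((EuclideanSpace ℝ (Fin 3)), ℂ)) = ((2 * Real.pi) ^ 2 / 2 : ℂ) •
        smulLeftCLM ℂ (fun x : (EuclideanSpace ℝ (Fin 3)) ↦ Complex.ofReal (‖x‖ ^ 2)) ((𝓕 f : L2) : 𝓢'((EuclideanSpace ℝ (Fin 3)), ℂ)) := by
    change (g : 𝓢'((EuclideanSpace ℝ (Fin 3)), ℂ)) = (-(1 / 2) : ℂ) • Δ (f : 𝓢'((EuclideanSpace ℝ (Fin 3)), ℂ)) ↔ _
    rw [← Lp.fourier_toTemperedDistribution_eq, ← Lp.fourier_toTemperedDistribution_eq,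
      laplacian_eq_fourierMultiplierCLM, fourierMultiplierCLM_apply]
    rw [← (FourierTransform.fourierEquiv ℂ 𝓢'((EuclideanSpace ℝ (Fin 3)), ℂ)).injective.eq_iff]
    simp only [FourierTransform.fourierEquiv_apply, FourierTransform.fourier_smul]
    rw [← Complex.coe_smul (-(2 * Real.pi) ^ 2)]
    simp only [FourierTransform.fourier_smul, FourierTransform.fourier_fourierInv_eq, smul_smul]
    push_cast
    rw [show (-(1 / 2) * -(2 * (Real.pi:ℂ)) ^ 2 ) = (2 * Real.pi) ^ 2 / 2 by ring]
  rw [e1]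
  have hg : (fun x : (EuclideanSpace ℝ (Fin 3)) ↦ Complex.ofReal (‖x‖ ^ 2)).HasTemperateGrowth := by fun_prop
  have key : ∀ u : 𝓢((EuclideanSpace ℝ (Fin 3)), ℂ), (((2 * Real.pi) ^ 2 / 2 : ℂ) •
        smulLeftCLM ℂ (fun x : (EuclideanSpace ℝ (Fin 3)) ↦ Complex.ofReal (‖x‖ ^ 2)) ((𝓕 f : L2) : 𝓢'((EuclideanSpace ℝ (Fin 3)), ℂ))) u
        = ∫ x, u x • ((((2 * Real.pi * ‖x‖) ^ 2 / 2 : ℝ) : ℂ) * (𝓕 f : L2) x) := by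
    intro u
    change ((2 * Real.pi) ^ 2 / 2 : ℂ) • (smulLeftCLM ℂ (fun x : (EuclideanSpace ℝ (Fin 3)) ↦ Complex.ofReal (‖x‖ ^ 2)) ((𝓕 f : L2) : 𝓢'((EuclideanSpace ℝ (Fin 3)), ℂ)) u) = _
    rw [smulLeftCLM_apply_apply, Lp.toTemperedDistribution_apply, ← integral_smul]
    congr 1
    ext x
    rw [SchwartzMap.smulLeftCLM_apply_apply hg]
    simp; ring
  have hloc : ∀ h : L2, LocallyIntegrable (h : (EuclideanSpace ℝ (Fin 3)) → ℂ) volume := fun h =>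
    (Lp.memLp h).locallyIntegrable (by norm_num)
  constructor
  · intro h
    have hl : LocallyIntegrable (fun x : (EuclideanSpace ℝ (Fin 3)) => (((2 * Real.pi * ‖x‖) ^ 2 / 2 : ℝ) : ℂ) * (𝓕 f : L2) x) volume := by
      have := (hloc (𝓕 f)).locallyIntegrableOn Set.univ
      rw [← locallyIntegrableOn_univ]
      exact this.continuousOn_mul (by fun_prop) isOpen_univ.isLocallyClosed
    have := ae_eq_of_integral_contDiff_smul_eq (hloc (𝓕 g)) hl ?_
    · exact this
    intro φ h1 h2
    have hφ : ContDiff ℝ (⊤:ℕ∞) (fun x => (φ x : ℂ)) :=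
      Complex.ofRealCLM.contDiff.comp h1
    have h2' : HasCompactSupport (fun x => (φ x : ℂ)) := h2.comp_left (g := Complex.ofReal) rfl
    have h3 := congrArg (fun T : 𝓢'((EuclideanSpace ℝ (Fin 3)), ℂ) => T (h2'.toSchwartzMap hφ)) h
    simp only [key] at h3
    rw [Lp.toTemperedDistribution_apply] at h3
    simpa using h3
  · intro h
    ext u
    rw [key, Lp.toTemperedDistribution_apply]
    apply integral_congr_ae
    filter_upwards [h] with x hx
    rw [hx]

/-- `H₀^{1/2} H₀^{1/2} = H₀`, including the domains. -/
theorem mem_freeHamiltonianGraph_iff_sqrt (f h : L2) : (f, h) ∈ freeHamiltonianGraph ↔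
    ∃ g, (f, g) ∈ sqrtFreeHamiltonianGraph ∧ (g, h) ∈ sqrtFreeHamiltonianGraph := by
  have hm : ∀ x : ℝ, ((2 * Real.pi * x / √2 : ℝ):ℂ) * ((2 * Real.pi * x / √2 : ℝ):ℂ) = (((2 * Real.pi * x) ^ 2 / 2 : ℝ) : ℂ) := by
    intro x
    rw [← Complex.ofReal_mul]
    congr 1
    rw [div_mul_div_comm, Real.mul_self_sqrt (by norm_num)]; ring
  rw [mem_freeHamiltonianGraph_iff]
  constructor
  · intro hh
    have hmem : MemLp (fun ξ : (EuclideanSpace ℝ (Fin 3)) => ((2 * Real.pi * ‖ξ‖ / √2 : ℝ):ℂ) * (𝓕 f : L2) ξ) 2 volume := by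
      have hs := (Lp.memLp (𝓕 f : L2)).norm.add (Lp.memLp (𝓕 h : L2)).norm
      refine hs.mono (by
        refine AEStronglyMeasurable.mul ?_ (Lp.memLp (𝓕 f : L2)).1
        exact (by fun_prop : Continuous fun ξ : (EuclideanSpace ℝ (Fin 3)) => ((2 * Real.pi * ‖ξ‖ / √2 : ℝ):ℂ)).aestronglyMeasurable) ?_
      filter_upwards [hh] with ξ hξ
      simp only [Pi.add_apply]
      rw [hξ, ← hm, norm_mul, norm_mul, norm_mul]
      set a := ‖((2 * Real.pi * ‖ξ‖ / √2 : ℝ):ℂ)‖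
      set b := ‖(𝓕 f : L2) ξ‖
      have ha : 0 ≤ a := norm_nonneg _
      have hb : 0 ≤ b := norm_nonneg _
      rw [Real.norm_of_nonneg (by positivity)]
      nlinarith [mul_nonneg hb (sq_nonneg (a - 1)), mul_nonneg hb (sq_nonneg a)]
    refine ⟨𝓕⁻ (hmem.toLp _), ?_, ?_⟩
    · change ∀ᵐ ξ, (𝓕 (𝓕⁻ (hmem.toLp _)) : L2) ξ = _
      rw [FourierTransform.fourier_fourierInv_eq]
      exact hmem.coeFn_toLp
    · change ∀ᵐ ξ, _ = _ * (𝓕 (𝓕⁻ (hmem.toLp _)) : L2) ξ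
      rw [FourierTransform.fourier_fourierInv_eq]
      filter_upwards [hh, hmem.coeFn_toLp] with ξ h1 h2
      rw [h1, h2, ← hm, mul_assoc]
  · rintro ⟨g, h1, h2⟩
    filter_upwards [h1, h2] with ξ h1 h2
    rw [h2, h1, ← hm]
    ring

/-- `H₀ ρ` on its natural domain. -/
def leftProd (ρ : L2 →L[ℂ] L2) : L2 →ₗ.[ℂ] L2 :=
  pcomp freeHamiltonian ((ρ : L2 →ₗ[ℂ] L2).toPMap ⊤)

/-- `H₀^{1/2} ρ H₀^{1/2}` on its natural domain. -/
def sandwich (ρ : L2 →L[ℂ] L2) : L2 →ₗ.[ℂ] L2 :=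
  pcomp sqrtFreeHamiltonian ((ρ : L2 →ₗ[ℂ] L2).compPMap sqrtFreeHamiltonian)

/-! ### The spaces `Z` and `Y` -/

/-- The Hermitian trace class `ρ` for which `H₀^{1/2} ρ H₀^{1/2}` is defined on all of `H¹(ℝ³)`,
the domain of `H₀^{1/2}`, and has a trace class closure. -/
def Z : Set (L2 →L[ℂ] L2) :=
  {ρ | IsSelfAdjoint ρ ∧ traceNorm ρ < ∞ ∧ sqrtFreeHamiltonian.domain ≤ (sandwich ρ).domain ∧
    pTraceNorm (sandwich ρ).closure < ∞}

def normZ (ρ : L2 →L[ℂ] L2) : ℝ :=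
  (traceNorm ρ + pTraceNorm (sandwich ρ).closure).toReal

/-- The Hermitian trace class `ρ` for which `H₀ ρ` is trace class (in particular defined on all
of `L²`). -/
def Y : Set (L2 →L[ℂ] L2) :=
  {ρ | IsSelfAdjoint ρ ∧ traceNorm ρ < ∞ ∧ pTraceNorm (leftProd ρ) < ∞}

def normY (ρ : L2 →L[ℂ] L2) : ℝ :=
  (traceNorm ρ + pTraceNorm (leftProd ρ)).toReal

universe u

/-- The subset `S` of the real vector space `V` is a linear subspace, and `N` restricts to a norm
on `S` that makes it a Banach space: `S` is the image of a real Banach space under an injective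
linear map that turns its norm into `N`. -/
def IsRealBanachSpace {V : Type u} [AddCommGroup V] [Module ℝ V] (S : Set V) (N : V → ℝ) : Prop :=
  ∃ (E : Type u) (_ : NormedAddCommGroup E) (_ : NormedSpace ℝ E) (j : E →ₗ[ℝ] V),
    CompleteSpace E ∧ Function.Injective j ∧ Set.range j = S ∧ ∀ x, ‖x‖ = N (j x)

end HartreeFock

end

/-! Two devices reduce everything to bounded operators. First, the trace norm is the supremum of `∑
|⟨f i, T (e i)⟩|` over finite Bessel families. In this form subadditivity, stability under
composition with contractions, and lower semicontinuity under strong convergence are immediate; the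
polar decomposition and the Hilbert-Schmidt factorization `|T| = S S` identify it with `Tr |T|`
(`traceNorm_eq_besselNorm`). Second, with `A = H₀^{1/2}` and `P n` the projection onto momenta `|ξ|
≤ n`, the operator `A n = P n A` is bounded, and `g = A f` holds iff `A n f = P n g` for all `n`.

Completeness: `Z` and `Y` are projections of closed sets of pairs `(ρ, τ)`, with `τ` the closure of
`A ρ A` or the product `A² ρ`. The sum of two lower semicontinuous norms that dominate the operator
norm is complete on the pairs of finite norm (`isRealBanachSpace_of_closed_graph`).

Inclusion: for self-adjoint `ρ`, `‖A n ρ A n‖₁ ≤ ‖(A n)² ρ‖₁ ≤ ‖H₀ ρ‖₁`. The first bound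
(`besselNorm_conj_le`) comes from cyclicity of the trace applied to the positive and negative parts
of `ρ`; letting `n → ∞` gives a trace class closure of `A ρ A` (`Cutoff.exists_sandwich`).

Density: `P n ρ P n` lies in `Y`. Since `P n` commutes with `A`, its sandwich is `P n τ P n`, and
compressions of a trace class operator converge to it in trace norm
(`tendsto_besselNorm_sub_compression`). -/

noncomputable section

namespace HartreeFock

open MeasureTheory Filter Topology
open scoped ENNReal

/-! ### Variational trace norm -/

section TraceNorm

variable {H : Type*} [NormedAddCommGroup H] [InnerProductSpace ℂ H]

/-- A finite family satisfying Bessel's inequality. -/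
def IsBessel {ι : Type*} [Fintype ι] (e : ι → H) : Prop :=
  ∀ x : H, ∑ i, ‖inner ℂ (e i) x‖ ^ 2 ≤ ‖x‖ ^ 2

theorem isBessel_of_orthonormal {ι : Type*} [Fintype ι] {e : ι → H} (he : Orthonormal ℂ e) :
    IsBessel e := fun x => he.sum_inner_products_le x

/-- The trace norm in its variational form. -/
def besselNorm (T : H →L[ℂ] H) : ℝ≥0∞ :=
  ⨆ (n : ℕ) (e : Fin n → H) (f : Fin n → H) (_ : IsBessel e) (_ : IsBessel f),
    ∑ i, ‖inner ℂ (f i) (T (e i))‖ₑ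

theorem besselNorm_le_iff {T : H →L[ℂ] H} {C : ℝ≥0∞} : besselNorm T ≤ C ↔
    ∀ (n : ℕ) (e f : Fin n → H), IsBessel e → IsBessel f →
      ∑ i, ‖inner ℂ (f i) (T (e i))‖ₑ ≤ C := by
  simp only [besselNorm, iSup_le_iff]

theorem sum_le_besselNorm (T : H →L[ℂ] H) {n : ℕ} {e f : Fin n → H} (he : IsBessel e)
    (hf : IsBessel f) : ∑ i, ‖inner ℂ (f i) (T (e i))‖ₑ ≤ besselNorm T :=
  besselNorm_le_iff.1 le_rfl n e f he hf

theorem sum_le_besselNorm_of_orthonormal (T : H →L[ℂ] H) {ι : Type*} {b : ι → H}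
    (hb : Orthonormal ℂ b) (s : Finset ι) :
    ∑ i ∈ s, ‖inner ℂ (b i) (T (b i))‖ₑ ≤ besselNorm T := by
  have h : Orthonormal ℂ fun k : Fin s.card => b (s.equivFin.symm k) :=
    hb.comp _ (Subtype.val_injective.comp s.equivFin.symm.injective)
  rw [← Finset.sum_coe_sort, ← s.equivFin.symm.sum_comp]
  exact sum_le_besselNorm T (isBessel_of_orthonormal h) (isBessel_of_orthonormal h)

theorem besselNorm_add_le (S T : H →L[ℂ] H) :
    besselNorm (S + T) ≤ besselNorm S + besselNorm T := by
  refine besselNorm_le_iff.2 fun n e f he hf => ?_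
  refine le_trans ?_ (add_le_add (sum_le_besselNorm S he hf) (sum_le_besselNorm T he hf))
  rw [← Finset.sum_add_distrib]
  refine Finset.sum_le_sum fun i _ => ?_
  rw [add_apply, inner_add_right]
  exact enorm_add_le _ _

theorem besselNorm_smul_le (c : ℂ) (T : H →L[ℂ] H) :
    besselNorm (c • T) ≤ ‖c‖ₑ * besselNorm T := by
  refine besselNorm_le_iff.2 fun n e f he hf => ?_
  refine le_trans (le_of_eq ?_) (mul_le_mul_right (sum_le_besselNorm T he hf) _)
  rw [Finset.mul_sum]
  exact Finset.sum_congr rfl fun i _ => by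
    rw [smul_apply, inner_smul_right, enorm_mul]

theorem besselNorm_neg (T : H →L[ℂ] H) : besselNorm (-T) = besselNorm T := by
  simp [besselNorm]

theorem besselNorm_sub_le (S T : H →L[ℂ] H) :
    besselNorm (S - T) ≤ besselNorm S + besselNorm T := by
  rw [sub_eq_add_neg, ← besselNorm_neg T]
  exact besselNorm_add_le _ _

/-- A single unit vector is a Bessel family; test with `x` and the normalized `T x`. -/
theorem enorm_le_besselNorm (T : H →L[ℂ] H) : ‖T‖ₑ ≤ besselNorm T := by
  by_cases hT : besselNorm T = ∞
  · simp [hT]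
  have key : ∀ x y : H, ‖x‖ = 1 → ‖y‖ = 1 → ‖inner ℂ y (T x)‖ ≤ (besselNorm T).toReal := by
    intro x y hx hy
    have hB : ∀ z : H, ‖z‖ = 1 → IsBessel fun _ : Fin 1 => z := by
      intro z hz w
      have := norm_inner_le_norm (𝕜 := ℂ) z w
      rw [hz, one_mul] at this
      simpa using pow_le_pow_left₀ (norm_nonneg _) this 2
    have := sum_le_besselNorm T (hB x hx) (hB y hy)
    rw [Fin.sum_univ_one, ← ofReal_norm] at this
    exact (ENNReal.ofReal_le_iff_le_toReal hT).1 this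
  rw [← ofReal_norm]
  refine ENNReal.ofReal_le_of_le_toReal ?_
  refine ContinuousLinearMap.opNorm_le_of_unit_norm ENNReal.toReal_nonneg fun x hx => ?_
  by_cases h0 : T x = 0
  · simp [h0]
  have := key x ((‖T x‖⁻¹ : ℂ) • T x) hx (by
    rw [norm_smul]; simp [h0])
  rw [inner_smul_left, norm_mul, inner_self_eq_norm_sq_to_K] at this
  simpa [pow_two, h0] using this

/-- Each finite sum in the supremum is continuous for the strong topology, so the supremum is lower
semicontinuous. -/
theorem besselNorm_le_of_tendsto {T : ℕ → H →L[ℂ] H} {S : H →L[ℂ] H} {C : ℝ≥0∞}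
    (hT : ∀ x, Tendsto (fun n => T n x) atTop (𝓝 (S x)))
    (hC : ∀ᶠ n in atTop, besselNorm (T n) ≤ C) :
    besselNorm S ≤ C := by
  refine besselNorm_le_iff.2 fun n e f he hf => ?_
  have : Tendsto (fun k => ∑ i, ‖inner ℂ (f i) (T k (e i))‖ₑ) atTop
      (𝓝 (∑ i, ‖inner ℂ (f i) (S (e i))‖ₑ)) :=
    tendsto_finsetSum _ fun i _ => (tendsto_const_nhds.inner (hT (e i))).enorm
  exact le_of_tendsto this (hC.mono fun k hk => (sum_le_besselNorm _ he hf).trans hk)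

variable [CompleteSpace H]

/-- Douglas' factorization lemma for contractions. -/
theorem exists_contraction_factor {T S : H →L[ℂ] H} (h : ∀ x, ‖T x‖ ≤ ‖S x‖) :
    ∃ U : H →L[ℂ] H, ‖U‖ ≤ 1 ∧ T = U ∘L S := by
  set K : Submodule ℂ H := (LinearMap.range (S : H →ₗ[ℂ] H)).topologicalClosure with hK
  have hmem : ∀ x, S x ∈ K := fun x =>
    Submodule.le_topologicalClosure _ (LinearMap.mem_range_self (S : H →ₗ[ℂ] H) x)
  let e : H →ₗ[ℂ] K := (S : H →ₗ[ℂ] H).codRestrict K hmem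
  have hd : DenseRange e := by
    intro y
    rw [Metric.mem_closure_iff]
    intro ε hε
    obtain ⟨z, ⟨x, rfl⟩, hz⟩ := Metric.mem_closure_iff.1 y.2 ε hε
    exact ⟨e x, ⟨x, rfl⟩, hz⟩
  have hb : ∀ x, ‖(T : H →ₗ[ℂ] H) x‖ ≤ 1 * ‖e x‖ := fun x => by
    rw [one_mul]
    exact h x
  have : CompleteSpace K := (Submodule.isClosed_topologicalClosure _).completeSpace_coe
  -- `S x ↦ T x` is a well-defined contraction on the range of `S`; extend it to the closure `K`,
  -- and by zero on the complement.
  refine ⟨((T : H →ₗ[ℂ] H).extendOfNorm e) ∘L K.orthogonalProjectionOnto, ?_, ?_⟩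
  · refine (ContinuousLinearMap.opNorm_comp_le _ _).trans ?_
    exact mul_le_one₀ (LinearMap.opNorm_extendOfNorm_le hd zero_le_one hb) (norm_nonneg _)
      (Submodule.orthogonalProjectionOnto_norm_le K)
  · ext x
    have h1 : K.orthogonalProjectionOnto (S x) = e x :=
      Submodule.orthogonalProjectionOnto_mem_subspace_eq_self (e x)
    have h2 := LinearMap.extendOfNorm_eq hd ⟨1, hb⟩ x
    simp [h1, h2]

/-- This is why Bessel families replace orthonormal ones: contractions preserve Bessel's inequality,
but not orthonormality. -/
theorem IsBessel.map {ι : Type*} [Fintype ι] {e : ι → H} (he : IsBessel e) {U : H →L[ℂ] H}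
    (hU : ‖U‖ ≤ 1) : IsBessel fun i => U (e i) := by
  intro x
  simp only [← ContinuousLinearMap.adjoint_inner_right U]
  refine (he _).trans ?_
  gcongr
  refine ContinuousLinearMap.le_of_opNorm_le _ ?_ x |>.trans (one_mul _).le
  simpa using hU

theorem besselNorm_comp_left_le {U : H →L[ℂ] H} (hU : ‖U‖ ≤ 1) (T : H →L[ℂ] H) :
    besselNorm (U ∘L T) ≤ besselNorm T := by
  refine besselNorm_le_iff.2 fun n e f he hf => ?_
  have hU' : ‖ContinuousLinearMap.adjoint U‖ ≤ 1 := by simpa using hU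
  simpa [ContinuousLinearMap.adjoint_inner_left] using sum_le_besselNorm T he (hf.map hU')

theorem besselNorm_comp_right_le {U : H →L[ℂ] H} (hU : ‖U‖ ≤ 1) (T : H →L[ℂ] H) :
    besselNorm (T ∘L U) ≤ besselNorm T :=
  besselNorm_le_iff.2 fun _ _ _ he hf => sum_le_besselNorm T (he.map hU) hf

theorem besselNorm_comp_left_lt_top (S : H →L[ℂ] H) {T : H →L[ℂ] H} (hT : besselNorm T < ∞) :
    besselNorm (S ∘L T) < ∞ := by
  -- Rescale `S` to a contraction; the `+ 1` avoids the case `S = 0`.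
  set c : ℂ := ((‖S‖ + 1 : ℝ) : ℂ) with hc
  have hc0 : c ≠ 0 := by
    rw [hc]; exact_mod_cast (by positivity : ‖S‖ + 1 ≠ 0)
  have hU : ‖c⁻¹ • S‖ ≤ 1 := by
    rw [norm_smul, norm_inv, hc, Complex.norm_real, Real.norm_of_nonneg (by positivity),
      inv_mul_le_iff₀ (by positivity)]
    linarith
  have h : S ∘L T = c • ((c⁻¹ • S) ∘L T) := by
    rw [ContinuousLinearMap.smul_comp, smul_smul, mul_inv_cancel₀ hc0, one_smul]
  rw [h]
  exact (besselNorm_smul_le _ _).trans_lt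
    (ENNReal.mul_lt_top enorm_lt_top ((besselNorm_comp_left_le hU T).trans_lt hT))

theorem besselNorm_adjoint (T : H →L[ℂ] H) :
    besselNorm (ContinuousLinearMap.adjoint T) = besselNorm T := by
  have h : ∀ T : H →L[ℂ] H, besselNorm (ContinuousLinearMap.adjoint T) ≤ besselNorm T := by
    intro T
    refine besselNorm_le_iff.2 fun n e f he hf => ?_
    refine le_trans (le_of_eq ?_) (sum_le_besselNorm T hf he)
    refine Finset.sum_congr rfl fun i _ => ?_
    rw [ContinuousLinearMap.adjoint_inner_right, ← inner_conj_symm, RCLike.enorm_conj]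
  refine le_antisymm (h T) ?_
  simpa using h (ContinuousLinearMap.adjoint T)

end TraceNorm

/-! ### Hilbert-Schmidt operators and `Tr |T|` -/

section HilbertSchmidt

variable {H : Type*} [NormedAddCommGroup H] [InnerProductSpace ℂ H]

theorem IsBessel.sum_enorm_inner_sq_le {ι : Type*} [Fintype ι] {e : ι → H} (he : IsBessel e)
    (x : H) : ∑ i, ‖inner ℂ (e i) x‖ₑ ^ 2 ≤ ‖x‖ₑ ^ 2 := by
  have := ENNReal.ofReal_le_ofReal (he x)
  rw [ENNReal.ofReal_sum_of_nonneg fun _ _ => sq_nonneg _] at this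
  simpa [ENNReal.ofReal_pow, ofReal_norm] using this

theorem hasSum_norm_inner_sq {ι : Type*} (b : HilbertBasis ι ℂ H) (x : H) :
    HasSum (fun i => ‖inner ℂ (b i) x‖ ^ 2) (‖x‖ ^ 2) := by
  have h := b.hasSum_inner_mul_inner x x
  have h2 := Complex.hasSum_re h
  convert h2 using 1
  · ext i
    rw [← inner_conj_symm (b i) x, RCLike.mul_conj, RCLike.norm_conj]
    norm_cast
  · rw [← RCLike.re_eq_complex_re, inner_self_eq_norm_sq]

theorem tsum_enorm_inner_sq {ι : Type*} (b : HilbertBasis ι ℂ H) (x : H) :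
    ∑' i, ‖inner ℂ (b i) x‖ₑ ^ 2 = ‖x‖ₑ ^ 2 := by
  have h := hasSum_norm_inner_sq b x
  have := ENNReal.ofReal_tsum_of_nonneg (fun i => sq_nonneg ‖inner ℂ (b i) x‖) h.summable
  rw [h.tsum_eq] at this
  simpa [ENNReal.ofReal_pow, ofReal_norm] using this.symm

variable [CompleteSpace H]

variable (H) in
/-- The Hilbert basis used in `posTrace`. -/
def traceBasis : HilbertBasis (exists_hilbertBasis ℂ H).choose ℂ H :=
  (exists_hilbertBasis ℂ H).choose_spec.choose

/-- The square of the Hilbert-Schmidt norm. -/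
def hsNormSq (S : H →L[ℂ] H) : ℝ≥0∞ := ∑' i, ‖S (traceBasis H i)‖ₑ ^ 2

/-- Expand `‖S (e i)‖²` by Parseval, exchange the sums, and apply Bessel's inequality to each
adjoint image of a basis vector. -/
theorem IsBessel.sum_enorm_sq_le_hsNormSq_adjoint {ι : Type*} [Fintype ι] {e : ι → H}
    (he : IsBessel e) (S : H →L[ℂ] H) :
    ∑ i, ‖S (e i)‖ₑ ^ 2 ≤ hsNormSq (ContinuousLinearMap.adjoint S) := by
  simp only [← tsum_enorm_inner_sq (traceBasis H) (S _)]
  rw [← Summable.tsum_finsetSum fun _ _ => ENNReal.summable]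
  refine ENNReal.tsum_le_tsum fun j => ?_
  refine le_trans (le_of_eq ?_) (he.sum_enorm_inner_sq_le _)
  refine Finset.sum_congr rfl fun i _ => ?_
  rw [← ContinuousLinearMap.adjoint_inner_left, ← inner_conj_symm, RCLike.enorm_conj]

theorem hsNormSq_adjoint (S : H →L[ℂ] H) :
    hsNormSq (ContinuousLinearMap.adjoint S) = hsNormSq S := by
  have h : ∀ S : H →L[ℂ] H, hsNormSq S ≤ hsNormSq (ContinuousLinearMap.adjoint S) := by
    intro S
    rw [hsNormSq, ENNReal.tsum_eq_iSup_sum]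
    refine iSup_le fun s => ?_
    have hb : IsBessel fun i : s => traceBasis H i :=
      isBessel_of_orthonormal ((traceBasis H).orthonormal.comp _ Subtype.val_injective)
    have := hb.sum_enorm_sq_le_hsNormSq_adjoint S
    rwa [Finset.sum_coe_sort s fun i => ‖S (traceBasis H i)‖ₑ ^ 2] at this
  refine le_antisymm ?_ (h S)
  simpa using h (ContinuousLinearMap.adjoint S)

theorem hsNormSq_comp_lt_top (X : H →L[ℂ] H) {S : H →L[ℂ] H} (hS : hsNormSq S < ∞) :
    hsNormSq (X ∘L S) < ∞ := by
  have h : hsNormSq (X ∘L S) ≤ ‖X‖ₑ ^ 2 * hsNormSq S := by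
    rw [hsNormSq, hsNormSq, ← ENNReal.tsum_mul_left]
    refine ENNReal.tsum_le_tsum fun i => ?_
    rw [← mul_pow]
    exact pow_le_pow_left' (X.le_opENorm _) 2
  exact h.trans_lt (ENNReal.mul_lt_top (ENNReal.pow_lt_top enorm_lt_top) hS)

/-- Move `X` to the other side of the inner product; then use Cauchy-Schwarz in `H` and again for
the finite sum. -/
theorem besselNorm_comp_le_hs (X Y : H →L[ℂ] H) :
    besselNorm (X ∘L Y) ≤ hsNormSq X ^ (1 / 2 : ℝ) * hsNormSq Y ^ (1 / 2 : ℝ) := by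
  refine besselNorm_le_iff.2 fun n e f he hf => ?_
  have h1 : ∑ i, ‖inner ℂ (f i) ((X ∘L Y) (e i))‖ₑ ≤
      ∑ i, ‖ContinuousLinearMap.adjoint X (f i)‖ₑ * ‖Y (e i)‖ₑ := by
    refine Finset.sum_le_sum fun i _ => ?_
    rw [ContinuousLinearMap.comp_apply, ← ContinuousLinearMap.adjoint_inner_left]
    simpa [← ofReal_norm, ← ENNReal.ofReal_mul] using
      ENNReal.ofReal_le_ofReal
        (norm_inner_le_norm (𝕜 := ℂ) (ContinuousLinearMap.adjoint X (f i)) (Y (e i)))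
  refine h1.trans ((ENNReal.inner_le_Lp_mul_Lq Finset.univ _ _
    (Real.HolderConjugate.two_two)).trans ?_)
  have h2 := hf.sum_enorm_sq_le_hsNormSq_adjoint (ContinuousLinearMap.adjoint X)
  have h3 := he.sum_enorm_sq_le_hsNormSq_adjoint Y
  rw [ContinuousLinearMap.adjoint_adjoint] at h2
  rw [hsNormSq_adjoint] at h3
  norm_cast
  gcongr

theorem inner_sqrt_sqrt {R : H →L[ℂ] H} (hR : 0 ≤ R) (x y : H) :
    inner ℂ (CFC.sqrt R x) (CFC.sqrt R y) = inner ℂ x (R y) := by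
  have hs : IsSelfAdjoint (CFC.sqrt R) := (CFC.sqrt_nonneg R).isSelfAdjoint
  rw [← ContinuousLinearMap.adjoint_inner_right, hs.adjoint_eq]
  conv_rhs => rw [← CFC.sqrt_mul_sqrt_self R hR]
  rfl

theorem posTrace_eq_hsNormSq {R : H →L[ℂ] H} (hR : 0 ≤ R) :
    posTrace R = hsNormSq (CFC.sqrt R) := by
  refine tsum_congr fun i => ?_
  change ENNReal.ofReal (RCLike.re (inner ℂ (traceBasis H i) (R (traceBasis H i)))) = _
  rw [← inner_sqrt_sqrt hR, inner_self_eq_norm_sq, ENNReal.ofReal_pow (norm_nonneg _), ofReal_norm]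

theorem posTrace_le_besselNorm (R : H →L[ℂ] H) : posTrace R ≤ besselNorm R := by
  rw [posTrace, ENNReal.tsum_eq_iSup_sum]
  refine iSup_le fun s => le_trans (Finset.sum_le_sum fun i _ => ?_)
    (sum_le_besselNorm_of_orthonormal R (traceBasis H).orthonormal s)
  rw [← ofReal_norm]
  exact ENNReal.ofReal_le_ofReal (RCLike.re_le_norm _)

theorem norm_abs_apply (T : H →L[ℂ] H) (x : H) : ‖CFC.abs T x‖ = ‖T x‖ := by
  have hs : IsSelfAdjoint (CFC.abs T) := (CFC.abs_nonneg T).isSelfAdjoint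
  have h : inner ℂ (CFC.abs T x) (CFC.abs T x) = inner ℂ (T x) (T x) := by
    rw [← ContinuousLinearMap.adjoint_inner_right, hs.adjoint_eq,
      ← ContinuousLinearMap.adjoint_inner_right T]
    exact congrArg (fun S : H →L[ℂ] H => inner ℂ x (S x)) (CFC.abs_mul_abs T)
  rw [inner_self_eq_norm_sq_to_K, inner_self_eq_norm_sq_to_K] at h
  have h' : ‖CFC.abs T x‖ ^ 2 = ‖T x‖ ^ 2 := by exact_mod_cast h
  exact (pow_left_inj₀ (norm_nonneg _) (norm_nonneg _) two_ne_zero).1 h'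

theorem exists_polar (T : H →L[ℂ] H) : ∃ U : H →L[ℂ] H, ‖U‖ ≤ 1 ∧ T = U ∘L CFC.abs T :=
  exists_contraction_factor fun x => (norm_abs_apply T x).ge

theorem besselNorm_abs (T : H →L[ℂ] H) : besselNorm (CFC.abs T) = besselNorm T := by
  obtain ⟨U, hU, h⟩ := exists_polar T
  obtain ⟨V, hV, h'⟩ := exists_contraction_factor fun x => (norm_abs_apply T x).le
  refine le_antisymm ?_ ?_
  · rw [h']; exact besselNorm_comp_left_le hV T
  · conv_lhs => rw [h]
    exact besselNorm_comp_left_le hU _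

/-- The basis of `posTrace` is one choice of test families. Conversely, `R` is the product of two
copies of its square root, whose squared Hilbert-Schmidt norm is the trace of `R`. -/
theorem posTrace_eq_besselNorm {R : H →L[ℂ] H} (hR : 0 ≤ R) : posTrace R = besselNorm R := by
  refine le_antisymm (posTrace_le_besselNorm R) ?_
  have h : besselNorm R = besselNorm (CFC.sqrt R ∘L CFC.sqrt R) := by
    conv_lhs => rw [← CFC.sqrt_mul_sqrt_self R hR]
    rfl
  rw [h, posTrace_eq_hsNormSq hR]
  refine (besselNorm_comp_le_hs _ _).trans (le_of_eq ?_)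
  rw [← ENNReal.mul_rpow_of_nonneg _ _ (by norm_num), ← pow_two, ← ENNReal.rpow_natCast,
    ← ENNReal.rpow_mul]
  norm_num

theorem traceNorm_eq_besselNorm (T : H →L[ℂ] H) : traceNorm T = besselNorm T := by
  rw [traceNorm, posTrace_eq_besselNorm (CFC.abs_nonneg T), besselNorm_abs]

/-- Dominated convergence for the sum over the basis, with majorant `C² ‖S b‖²`. -/
theorem tendsto_hsNormSq_comp {Q : ℕ → H →L[ℂ] H} {C : ℝ} (hQ : ∀ n, ‖Q n‖ ≤ C)
    (hQ0 : ∀ x, Tendsto (fun n => Q n x) atTop (𝓝 0)) {S : H →L[ℂ] H} (hS : hsNormSq S < ∞) :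
    Tendsto (fun n => hsNormSq (Q n ∘L S)) atTop (𝓝 0) := by
  have hsum : Summable fun i => ‖S (traceBasis H i)‖ ^ 2 := by
    have := ENNReal.summable_toReal (f := fun i => ‖S (traceBasis H i)‖ₑ ^ 2) hS.ne
    simpa using this
  have hsum2 : Summable fun i => C ^ 2 * ‖S (traceBasis H i)‖ ^ 2 := hsum.mul_left _
  have hb : ∀ n i, ‖Q n (S (traceBasis H i))‖ ^ 2 ≤ C ^ 2 * ‖S (traceBasis H i)‖ ^ 2 := by
    intro n i
    rw [← mul_pow]
    exact pow_le_pow_left₀ (norm_nonneg _) ((Q n).le_of_opNorm_le (hQ n) _) 2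
  have h := tendsto_tsum_of_dominated_convergence (𝓕 := atTop)
    (f := fun n i => ‖Q n (S (traceBasis H i))‖ ^ 2) (g := fun _ => (0 : ℝ)) hsum2
    (fun i => by simpa using ((hQ0 (S (traceBasis H i))).norm.pow 2))
    (Eventually.of_forall fun n i => by
      rw [Real.norm_of_nonneg (by positivity)]; exact hb n i)
  have h2 : ∀ n, hsNormSq (Q n ∘L S) =
      ENNReal.ofReal (∑' i, ‖Q n (S (traceBasis H i))‖ ^ 2) := by
    intro n
    rw [ENNReal.ofReal_tsum_of_nonneg (fun i => sq_nonneg _)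
      (Summable.of_nonneg_of_le (fun i => sq_nonneg _) (hb n) hsum2)]
    refine tsum_congr fun i => ?_
    rw [ENNReal.ofReal_pow (norm_nonneg _), ofReal_norm]; rfl
  simp only [h2]
  simpa using ENNReal.tendsto_ofReal h

theorem tendsto_besselNorm_comp {Q : ℕ → H →L[ℂ] H} {C : ℝ} (hQ : ∀ n, ‖Q n‖ ≤ C)
    (hQ0 : ∀ x, Tendsto (fun n => Q n x) atTop (𝓝 0)) {T : H →L[ℂ] H} (hT : besselNorm T < ∞) :
    Tendsto (fun n => besselNorm (Q n ∘L T)) atTop (𝓝 0) := by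
  obtain ⟨U, hU, h⟩ := exists_polar T
  have hR := CFC.abs_nonneg T
  set S := CFC.sqrt (CFC.abs T) with hSdef
  have hS : hsNormSq S < ∞ := by
    rwa [← posTrace_eq_hsNormSq hR, posTrace_eq_besselNorm hR, besselNorm_abs]
  -- A trace class operator is a product of two Hilbert-Schmidt operators, so strong convergence
  -- need only be used on the left factor.
  have hT' : T = (U ∘L S) ∘L S := by
    conv_lhs => rw [h, ← CFC.sqrt_mul_sqrt_self (CFC.abs T) hR]
    rfl
  have h1 := tendsto_hsNormSq_comp hQ hQ0 (hsNormSq_comp_lt_top U hS)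
  have h2 : Tendsto (fun n => hsNormSq (Q n ∘L (U ∘L S)) ^ (1 / 2 : ℝ) * hsNormSq S ^ (1 / 2 : ℝ))
      atTop (𝓝 (0 ^ (1 / 2 : ℝ) * hsNormSq S ^ (1 / 2 : ℝ))) :=
    ENNReal.Tendsto.mul_const (h1.ennrpow_const _)
      (Or.inr (ENNReal.rpow_ne_top_of_nonneg (by norm_num) hS.ne))
  rw [ENNReal.zero_rpow_of_pos (by norm_num), zero_mul] at h2
  refine tendsto_of_tendsto_of_tendsto_of_le_of_le tendsto_const_nhds h2 (fun _ => zero_le)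
    fun n => ?_
  have h3 := besselNorm_comp_le_hs (Q n ∘L (U ∘L S)) S
  rwa [ContinuousLinearMap.comp_assoc, ← hT'] at h3

theorem tendsto_besselNorm_sub_compression {P : ℕ → H →L[ℂ] H} (hP : ∀ n, ‖P n‖ ≤ 1)
    (hsa : ∀ n, IsSelfAdjoint (P n)) (hP1 : ∀ x, Tendsto (fun n => P n x) atTop (𝓝 x))
    {T : H →L[ℂ] H} (hT : besselNorm T < ∞) :
    Tendsto (fun n => besselNorm (T - P n ∘L T ∘L P n)) atTop (𝓝 0) := by
  have hQ : ∀ n, ‖ContinuousLinearMap.id ℂ H - P n‖ ≤ 2 := fun n =>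
    (norm_sub_le _ _).trans
      ((add_le_add ContinuousLinearMap.norm_id_le (hP n)).trans one_add_one_eq_two.le)
  have hQ0 : ∀ x, Tendsto (fun n => (ContinuousLinearMap.id ℂ H - P n) x) atTop (𝓝 0) := by
    intro x
    simpa using (tendsto_const_nhds (x := x)).sub (hP1 x)
  have h1 := tendsto_besselNorm_comp hQ hQ0 hT
  have h2 := tendsto_besselNorm_comp hQ hQ0 (T := ContinuousLinearMap.adjoint T)
    (by rwa [besselNorm_adjoint])
  have h3 := h1.add h2
  rw [add_zero] at h3
  refine tendsto_of_tendsto_of_tendsto_of_le_of_le tendsto_const_nhds h3 (fun _ => zero_le)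
    fun n => ?_
  -- `T - P T P = (1 - P) T + P T (1 - P)`. Taking an adjoint turns the factor `1 - P` on the right
  -- into one on the left.
  have e : T - P n ∘L T ∘L P n = (ContinuousLinearMap.id ℂ H - P n) ∘L T +
      P n ∘L ContinuousLinearMap.adjoint
        ((ContinuousLinearMap.id ℂ H - P n) ∘L ContinuousLinearMap.adjoint T) := by
    rw [ContinuousLinearMap.adjoint_comp, map_sub, (hsa n).adjoint_eq,
      ContinuousLinearMap.adjoint_id]
    ext x
    simp
  change besselNorm (T - P n ∘L T ∘L P n) ≤ _
  rw [e]
  refine (besselNorm_add_le _ _).trans (add_le_add le_rfl ?_)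
  exact (besselNorm_comp_left_le (hP n) _).trans (besselNorm_adjoint _).le

end HilbertSchmidt

/-! ### The inequality `‖A ρ A‖₁ ≤ ‖A² ρ‖₁` for bounded `A` -/

section Sandwich

variable {H : Type*} [NormedAddCommGroup H] [InnerProductSpace ℂ H] [CompleteSpace H]

theorem hasSum_norm_sq_of_hsNormSq {S : H →L[ℂ] H} (hS : hsNormSq S < ∞) :
    HasSum (fun i => ‖S (traceBasis H i)‖ ^ 2) (hsNormSq S).toReal := by
  have := ENNReal.hasSum_toReal (f := fun i => ‖S (traceBasis H i)‖ₑ ^ 2) hS.ne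
  rw [hsNormSq, ENNReal.tsum_toReal_eq fun _ => by finiteness]
  simpa using this

theorem hsNormSq_neg (S : H →L[ℂ] H) : hsNormSq (-S) = hsNormSq S := by
  simp [hsNormSq]

theorem hsNormSq_add_lt_top {X Y : H →L[ℂ] H} (hX : hsNormSq X < ∞) (hY : hsNormSq Y < ∞) :
    hsNormSq (X + Y) < ∞ := by
  have h : hsNormSq (X + Y) ≤ 2 * hsNormSq X + 2 * hsNormSq Y := by
    rw [hsNormSq, hsNormSq, hsNormSq, ← ENNReal.tsum_mul_left, ← ENNReal.tsum_mul_left,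
      ← ENNReal.tsum_add]
    refine ENNReal.tsum_le_tsum fun i => ?_
    have h0 := norm_add_le (X (traceBasis H i)) (Y (traceBasis H i))
    have h1 : ‖(X + Y) (traceBasis H i)‖ ^ 2 ≤
        2 * ‖X (traceBasis H i)‖ ^ 2 + 2 * ‖Y (traceBasis H i)‖ ^ 2 := by
      refine (pow_le_pow_left₀ (norm_nonneg _) h0 2).trans ?_
      nlinarith [sq_nonneg (‖X (traceBasis H i)‖ - ‖Y (traceBasis H i)‖)]
    have h2 := ENNReal.ofReal_le_ofReal h1
    rw [ENNReal.ofReal_add (by positivity) (by positivity), ENNReal.ofReal_mul (by norm_num),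
      ENNReal.ofReal_mul (by norm_num)] at h2
    simpa [ENNReal.ofReal_pow, ofReal_norm] using h2
  exact h.trans_lt (by finiteness)

theorem hasSum_re_inner {X Y : H →L[ℂ] H} (hX : hsNormSq X < ∞) (hY : hsNormSq Y < ∞) :
    HasSum (fun i => RCLike.re (inner ℂ (X (traceBasis H i)) (Y (traceBasis H i))))
      (((hsNormSq (X + Y)).toReal - (hsNormSq (X - Y)).toReal) / 4) := by
  have h1 := hasSum_norm_sq_of_hsNormSq (hsNormSq_add_lt_top hX hY)
  have h2 := hasSum_norm_sq_of_hsNormSq (hsNormSq_add_lt_top hX (Y := -Y) (by rwa [hsNormSq_neg]))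
  rw [← sub_eq_add_neg] at h2
  have e : (fun i => RCLike.re (inner ℂ (X (traceBasis H i)) (Y (traceBasis H i)))) = fun i =>
      (‖(X + Y) (traceBasis H i)‖ ^ 2 - ‖(X - Y) (traceBasis H i)‖ ^ 2) / 4 := by
    ext i
    rw [re_inner_eq_norm_add_mul_self_sub_norm_sub_mul_self_div_four]
    simp [pow_two]
  rw [e]
  exact (h1.sub h2).div_const 4

/-- The real part of `Tr(X* Y) = Tr(Y X*)`, up to conjugation: by polarization the sum depends only
on Hilbert-Schmidt norms, which are invariant under adjoints. -/
theorem hasSum_re_inner_adjoint {X Y : H →L[ℂ] H} (hX : hsNormSq X < ∞) (hY : hsNormSq Y < ∞) :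
    HasSum (fun i => RCLike.re (inner ℂ (ContinuousLinearMap.adjoint X (traceBasis H i))
      (ContinuousLinearMap.adjoint Y (traceBasis H i))))
      (((hsNormSq (X + Y)).toReal - (hsNormSq (X - Y)).toReal) / 4) := by
  have h := hasSum_re_inner (X := ContinuousLinearMap.adjoint X)
    (Y := ContinuousLinearMap.adjoint Y) (by rwa [hsNormSq_adjoint]) (by rwa [hsNormSq_adjoint])
  rwa [← map_add, ← map_sub, hsNormSq_adjoint, hsNormSq_adjoint] at h

/-- With `S = R^{1/2}`, `Tr(A R A) = ‖A S‖²` in Hilbert-Schmidt norm, which is the pairing of `S`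
with `A A S`. Passing to adjoints turns this into the diagonal sum of `R A A`, whose partial sums
are at most its trace norm. -/
theorem posTrace_conj_le {R A : H →L[ℂ] H} (hR : 0 ≤ R) (hA : IsSelfAdjoint A)
    (hRt : besselNorm R < ∞) : posTrace (A ∘L R ∘L A) ≤ besselNorm (R ∘L A ∘L A) := by
  set S := CFC.sqrt R with hSdef
  have hSa : IsSelfAdjoint S := (CFC.sqrt_nonneg R).isSelfAdjoint
  have hS : hsNormSq S < ∞ := by
    rwa [← posTrace_eq_hsNormSq hR, posTrace_eq_besselNorm hR]
  have h1 : posTrace (A ∘L R ∘L A) = hsNormSq (A ∘L S) := by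
    rw [← hsNormSq_adjoint, ContinuousLinearMap.adjoint_comp, hSa.adjoint_eq, hA.adjoint_eq]
    refine tsum_congr fun i => ?_
    change ENNReal.ofReal (RCLike.re (inner ℂ (traceBasis H i) (A (R (A (traceBasis H i)))))) = _
    rw [← ContinuousLinearMap.adjoint_inner_left, hA.adjoint_eq, ← inner_sqrt_sqrt hR,
      inner_self_eq_norm_sq, ENNReal.ofReal_pow (norm_nonneg _), ofReal_norm]
    rfl
  have hAS := hsNormSq_comp_lt_top A hS
  have hAAS := hsNormSq_comp_lt_top A hAS
  have h2 := hasSum_norm_sq_of_hsNormSq hAS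
  have h3 := hasSum_re_inner hS hAAS
  have h4 := hasSum_re_inner_adjoint hS hAAS
  have h5 : (fun i => ‖(A ∘L S) (traceBasis H i)‖ ^ 2) = fun i =>
      RCLike.re (inner ℂ (S (traceBasis H i)) ((A ∘L A ∘L S) (traceBasis H i))) := by
    ext i
    simp only [ContinuousLinearMap.comp_apply]
    rw [← ContinuousLinearMap.adjoint_inner_left, hA.adjoint_eq, inner_self_eq_norm_sq]
  rw [h5] at h2
  rw [← h2.unique h3] at h4
  rw [h1]
  by_cases htop : besselNorm (R ∘L A ∘L A) = ∞
  · simp [htop]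
  rw [← ENNReal.toReal_le_toReal hAS.ne htop]
  refine hasSum_le_of_sum_le h4 fun s => ?_
  have h6 := sum_le_besselNorm_of_orthonormal (R ∘L A ∘L A) (traceBasis H).orthonormal s
  rw [← ENNReal.toReal_le_toReal (h6.trans_lt (lt_top_iff_ne_top.2 htop)).ne htop,
    ENNReal.toReal_sum fun _ _ => enorm_ne_top] at h6
  refine le_trans (Finset.sum_le_sum fun i _ => ?_) h6
  rw [ContinuousLinearMap.adjoint_comp, ContinuousLinearMap.adjoint_comp, hSa.adjoint_eq,
    hA.adjoint_eq]
  simp only [ContinuousLinearMap.comp_apply, toReal_enorm]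
  rw [inner_sqrt_sqrt hR]
  exact RCLike.re_le_norm _

/-- The trace norms of the conjugated positive and negative parts add up to `Tr(A |ρ| A)`, which
reduces to the positive case. Then `|ρ| = V ρ` with a contraction `V` removes the absolute value,
and an adjoint reverses the order. -/
theorem besselNorm_conj_le {ρ A : H →L[ℂ] H} (hρ : IsSelfAdjoint ρ) (hA : IsSelfAdjoint A)
    (hρt : besselNorm ρ < ∞) : besselNorm (A ∘L ρ ∘L A) ≤ besselNorm (A ∘L A ∘L ρ) := by
  have hpos : ∀ T : H →L[ℂ] H, 0 ≤ T → 0 ≤ A ∘L T ∘L A := fun T hT => hA.conjugate_nonneg hT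
  have hp := hpos _ (CFC.posPart_nonneg ρ)
  have hn := hpos _ (CFC.negPart_nonneg ρ)
  have e1 : A ∘L ρ ∘L A = A ∘L ρ⁺ ∘L A - A ∘L ρ⁻ ∘L A := by
    conv_lhs => rw [← CFC.posPart_sub_negPart ρ hρ]
    ext x; simp
  have e2 : A ∘L CFC.abs ρ ∘L A = A ∘L ρ⁺ ∘L A + A ∘L ρ⁻ ∘L A := by
    rw [← CFC.posPart_add_negPart ρ hρ]
    ext x; simp
  obtain ⟨V, hV, hV'⟩ := exists_contraction_factor fun x => (norm_abs_apply ρ x).le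
  have hre : ∀ T : H →L[ℂ] H, 0 ≤ T → ∀ x, 0 ≤ RCLike.re (inner ℂ x (T x)) := fun T hT x =>
    ((ContinuousLinearMap.nonneg_iff_isPositive T).1 hT).re_inner_nonneg_right x
  calc besselNorm (A ∘L ρ ∘L A)
      ≤ besselNorm (A ∘L ρ⁺ ∘L A) + besselNorm (A ∘L ρ⁻ ∘L A) := by
        rw [e1]; exact besselNorm_sub_le _ _
    _ = posTrace (A ∘L CFC.abs ρ ∘L A) := by
        rw [← posTrace_eq_besselNorm hp, ← posTrace_eq_besselNorm hn, e2, posTrace, posTrace,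
          posTrace, ← ENNReal.tsum_add]
        refine tsum_congr fun i => ?_
        rw [← ENNReal.ofReal_add (hre _ hp _) (hre _ hn _), add_apply, inner_add_right, map_add]
    _ ≤ besselNorm (CFC.abs ρ ∘L A ∘L A) :=
        posTrace_conj_le (CFC.abs_nonneg ρ) hA (by rwa [besselNorm_abs])
    _ ≤ besselNorm (ρ ∘L A ∘L A) := by
        rw [hV', ContinuousLinearMap.comp_assoc]
        exact besselNorm_comp_left_le hV _
    _ = besselNorm (A ∘L A ∘L ρ) := by
        rw [← besselNorm_adjoint, ContinuousLinearMap.adjoint_comp,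
          ContinuousLinearMap.adjoint_comp, hρ.adjoint_eq, hA.adjoint_eq,
          ContinuousLinearMap.comp_assoc]

end Sandwich

/-! ### Completeness of closed graphs under dominating norms -/

section Banach

universe u

/-- An extended norm on a Banach space that dominates the norm and is lower semicontinuous. -/
structure IsDominatingNorm {V : Type u} [NormedAddCommGroup V] [NormedSpace ℝ V]
    (N : V → ℝ≥0∞) : Prop where
  add_le : ∀ x y, N (x + y) ≤ N x + N y
  smul_le : ∀ (c : ℝ) x, N (c • x) ≤ ‖c‖ₑ * N x
  enorm_le : ∀ x, ‖x‖ₑ ≤ N x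
  le_of_tendsto : ∀ (v : ℕ → V) (x : V) (C : ℝ≥0∞), Tendsto v atTop (𝓝 x) →
    (∀ᶠ n in atTop, N (v n) ≤ C) → N x ≤ C

variable {V : Type u} [NormedAddCommGroup V] [NormedSpace ℝ V] {N : V → ℝ≥0∞}

theorem IsDominatingNorm.map_zero (hN : IsDominatingNorm N) : N 0 = 0 := by
  simpa using hN.smul_le 0 0

theorem IsDominatingNorm.map_neg (hN : IsDominatingNorm N) (x : V) : N (-x) = N x := by
  have h : ∀ x, N (-x) ≤ N x := fun x => by simpa using hN.smul_le (-1) x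
  exact le_antisymm (h x) (by simpa using h (-x))

/-- The pairs in `K` whose components both have a finite norm. -/
def finitePairs (hN : IsDominatingNorm N) (K : Submodule ℝ (V × V)) : Submodule ℝ (V × V) where
  carrier := {p | p ∈ K ∧ N p.1 < ∞ ∧ N p.2 < ∞}
  zero_mem' := ⟨K.zero_mem, by simp [hN.map_zero], by simp [hN.map_zero]⟩
  add_mem' {p q} hp hq := ⟨K.add_mem hp.1 hq.1,
    (hN.add_le _ _).trans_lt (ENNReal.add_lt_top.2 ⟨hp.2.1, hq.2.1⟩),
    (hN.add_le _ _).trans_lt (ENNReal.add_lt_top.2 ⟨hp.2.2, hq.2.2⟩)⟩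
  smul_mem' c p hp := ⟨K.smul_mem c hp.1,
    (hN.smul_le _ _).trans_lt (ENNReal.mul_lt_top enorm_lt_top hp.2.1),
    (hN.smul_le _ _).trans_lt (ENNReal.mul_lt_top enorm_lt_top hp.2.2)⟩

/-- The space `finitePairs hN K`, to be normed by `N p.1 + N p.2`. -/
def PairSpace (hN : IsDominatingNorm N) (K : Submodule ℝ (V × V)) : Type u := finitePairs hN K

variable (hN : IsDominatingNorm N) (K : Submodule ℝ (V × V))

instance : AddCommGroup (PairSpace hN K) := inferInstanceAs (AddCommGroup (finitePairs hN K))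

instance : Module ℝ (PairSpace hN K) := inferInstanceAs (Module ℝ (finitePairs hN K))

namespace PairSpace

variable {hN K}

/-- The underlying pair. -/
def toPair : PairSpace hN K →ₗ[ℝ] V × V := (finitePairs hN K).subtype

theorem toPair_injective : Function.Injective (toPair (hN := hN) (K := K)) :=
  Subtype.val_injective

theorem toPair_mem (p : PairSpace hN K) : p.toPair ∈ finitePairs hN K := Subtype.property p

/-- The sum of the norms of the components. -/
def pairNorm (p : PairSpace hN K) : ℝ := (N p.toPair.1 + N p.toPair.2).toReal

theorem pairNorm_nonneg (p : PairSpace hN K) : 0 ≤ p.pairNorm := ENNReal.toReal_nonneg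

theorem ofReal_pairNorm (p : PairSpace hN K) :
    ENNReal.ofReal p.pairNorm = N p.toPair.1 + N p.toPair.2 :=
  ENNReal.ofReal_toReal (ENNReal.add_lt_top.2 ⟨p.toPair_mem.2.1, p.toPair_mem.2.2⟩).ne

theorem pairNorm_le_iff {p : PairSpace hN K} {C : ℝ} (hC : 0 ≤ C) :
    p.pairNorm ≤ C ↔ N p.toPair.1 + N p.toPair.2 ≤ ENNReal.ofReal C := by
  rw [← ofReal_pairNorm, ENNReal.ofReal_le_ofReal_iff hC]

theorem norm_toPair_le (p : PairSpace hN K) : ‖p.toPair‖ ≤ p.pairNorm := by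
  have h : ∀ x : V, N x ≤ N p.toPair.1 + N p.toPair.2 → ‖x‖ ≤ p.pairNorm := by
    intro x hx
    have := (hN.enorm_le x).trans hx
    rwa [← ofReal_norm, ← ofReal_pairNorm, ENNReal.ofReal_le_ofReal_iff p.pairNorm_nonneg] at this
  exact max_le (h _ le_self_add) (h _ le_add_self)

instance : NormedAddCommGroup (PairSpace hN K) :=
  AddGroupNorm.toNormedAddCommGroup
    { toFun := pairNorm
      map_zero' := by simp [pairNorm, hN.map_zero]
      add_le' := fun p q => by
        rw [pairNorm_le_iff (add_nonneg p.pairNorm_nonneg q.pairNorm_nonneg),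
          ENNReal.ofReal_add p.pairNorm_nonneg q.pairNorm_nonneg, ofReal_pairNorm,
          ofReal_pairNorm, map_add, add_add_add_comm]
        exact add_le_add (hN.add_le _ _) (hN.add_le _ _)
      neg' := fun p => by simp [pairNorm, hN.map_neg]
      eq_zero_of_map_eq_zero' := fun p hp => by
        refine toPair_injective ?_
        have h := norm_toPair_le p
        rw [hp] at h
        rw [norm_le_zero_iff.1 h, map_zero] }

instance : NormedSpace ℝ (PairSpace hN K) where
  norm_smul_le c p := by
    change pairNorm (c • p) ≤ ‖c‖ * pairNorm p
    rw [pairNorm_le_iff (mul_nonneg (norm_nonneg _) p.pairNorm_nonneg),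
      ENNReal.ofReal_mul (norm_nonneg _), ofReal_pairNorm, map_smul, mul_add, ofReal_norm]
    exact add_le_add (hN.smul_le _ _) (hN.smul_le _ _)

theorem completeSpace [CompleteSpace V] (hK : IsClosed (K : Set (V × V))) :
    CompleteSpace (PairSpace hN K) := by
  refine Metric.complete_of_cauchySeq_tendsto fun v hv => ?_
  have hc : CauchySeq fun n => (v n).toPair := by
    rw [Metric.cauchySeq_iff] at hv ⊢
    intro ε hε
    obtain ⟨M, hM⟩ := hv ε hε
    refine ⟨M, fun m hm n hn => lt_of_le_of_lt ?_ (hM m hm n hn)⟩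
    rw [dist_eq_norm, dist_eq_norm, ← map_sub]
    exact norm_toPair_le _
  obtain ⟨p, hp⟩ := cauchySeq_tendsto_of_complete hc
  have hpK : p ∈ K := hK.mem_of_tendsto hp (Eventually.of_forall fun n => (v n).toPair_mem.1)
  -- Fix `m` in the Cauchy estimate and let `n → ∞`: lower semicontinuity upgrades convergence in `V
  -- × V` to convergence in `N`.
  have key : ∀ ε : ℝ, 0 < ε → ∃ M, ∀ m ≥ M, N ((v m).toPair.1 - p.1) ≤ ENNReal.ofReal ε ∧
      N ((v m).toPair.2 - p.2) ≤ ENNReal.ofReal ε := by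
    intro ε hε
    obtain ⟨M, hM⟩ := Metric.cauchySeq_iff.1 hv ε hε
    refine ⟨M, fun m hm => ?_⟩
    have hb : ∀ n ≥ M, N ((v m).toPair.1 - (v n).toPair.1) + N ((v m).toPair.2 - (v n).toPair.2) ≤
        ENNReal.ofReal ε := by
      intro n hn
      have h := (hM m hm n hn).le
      rw [dist_eq_norm] at h
      have h' := (pairNorm_le_iff hε.le).1 h
      rwa [map_sub] at h'
    exact ⟨hN.le_of_tendsto _ _ _ (tendsto_const_nhds.sub ((continuous_fst.tendsto _).comp hp))
        ((eventually_ge_atTop M).mono fun n hn => le_self_add.trans (hb n hn)),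
      hN.le_of_tendsto _ _ _ (tendsto_const_nhds.sub ((continuous_snd.tendsto _).comp hp))
        ((eventually_ge_atTop M).mono fun n hn => le_add_self.trans (hb n hn))⟩
  have hfin : p ∈ finitePairs hN K := by
    obtain ⟨M, hM⟩ := key 1 one_pos
    obtain ⟨h1, h2⟩ := hM M le_rfl
    have h3 := (v M).toPair_mem
    have fin : ∀ x y : V, N x < ∞ → N (x - y) ≤ ENNReal.ofReal 1 → N y < ∞ := by
      intro x y hx hxy
      have h := hN.add_le x (-(x - y))
      rw [hN.map_neg] at h
      rw [show x + -(x - y) = y by abel] at h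
      exact h.trans_lt (ENNReal.add_lt_top.2 ⟨hx, hxy.trans_lt ENNReal.ofReal_lt_top⟩)
    exact ⟨hpK, fin _ _ h3.2.1 h1, fin _ _ h3.2.2 h2⟩
  let w : PairSpace hN K := (⟨p, hfin⟩ : finitePairs hN K)
  refine ⟨w, Metric.tendsto_atTop.2 fun ε hε => ?_⟩
  obtain ⟨M, hM⟩ := key (ε / 3) (by positivity)
  refine ⟨M, fun n hn => ?_⟩
  rw [dist_eq_norm]
  obtain ⟨h1, h2⟩ := hM n hn
  have h3 : pairNorm (v n - w) ≤ ε / 3 + ε / 3 := by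
    rw [pairNorm_le_iff (by positivity), ENNReal.ofReal_add (by positivity) (by positivity),
      map_sub]
    exact add_le_add h1 h2
  exact lt_of_le_of_lt h3 (by linarith)

end PairSpace

/-- A closed graph in `V × V`, with the sum of two dominating norms, is a Banach space. -/
theorem isRealBanachSpace_of_closed_graph [CompleteSpace V] (hN : IsDominatingNorm N)
    (K : Submodule ℝ (V × V)) (hK : IsClosed (K : Set (V × V)))
    (hfun : ∀ y, ((0 : V), y) ∈ K → y = 0) {S : Set V} {M : V → ℝ}
    (hS : ∀ x, x ∈ S ↔ ∃ y, (x, y) ∈ K ∧ N x < ∞ ∧ N y < ∞)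
    (hM : ∀ x y, (x, y) ∈ K → M x = (N x + N y).toReal) : IsRealBanachSpace S M := by
  refine ⟨PairSpace hN K, inferInstance, inferInstance,
    LinearMap.fst ℝ V V ∘ₗ PairSpace.toPair, PairSpace.completeSpace hK, ?_, ?_, ?_⟩
  · rw [injective_iff_map_eq_zero]
    intro p hp
    refine PairSpace.toPair_injective ?_
    have hp1 : p.toPair.1 = 0 := hp
    have h := p.toPair_mem.1
    rw [map_zero]
    refine Prod.ext hp1 (hfun _ ?_)
    rwa [← hp1]
  · ext x
    rw [hS]
    constructor
    · rintro ⟨p, rfl⟩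
      exact ⟨p.toPair.2, p.toPair_mem⟩
    · rintro ⟨y, h⟩
      exact ⟨(⟨(x, y), h⟩ : finitePairs hN K), rfl⟩
  · intro p
    exact (hM _ _ p.toPair_mem.1).symm

end Banach

/-! ### Unbounded self-adjoint operators through bounded cutoffs -/

section Cutoff

variable {H : Type*} [NormedAddCommGroup H] [InnerProductSpace ℂ H] [CompleteSpace H]

variable (H) in
/-- Bounded approximations `A n = P n A` of a self-adjoint operator `A`, where the self-adjoint
contractions `P n` commute with `A` and converge strongly to the identity. -/
structure Cutoff where
  P : ℕ → H →L[ℂ] H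
  A : ℕ → H →L[ℂ] H
  isSelfAdjoint_P : ∀ n, IsSelfAdjoint (P n)
  isSelfAdjoint_A : ∀ n, IsSelfAdjoint (A n)
  norm_P_le : ∀ n, ‖P n‖ ≤ 1
  tendsto_P : ∀ x, Tendsto (fun n => P n x) atTop (𝓝 x)
  A_P : ∀ m n x, A n (P m x) = P n (A m x)
  P_A : ∀ n x, P n (A n x) = A n x

namespace Cutoff

variable (c : Cutoff H)

/-- The relation `g = A f` for the operator `A` approximated by `c`. -/
def Rel (f g : H) : Prop := ∀ n, c.A n f = c.P n g

variable {c}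

theorem rel_P (m : ℕ) (f : H) : c.Rel (c.P m f) (c.A m f) := fun n => c.A_P m n f

theorem Rel.unique {f g g' : H} (h : c.Rel f g) (h' : c.Rel f g') : g = g' := by
  refine tendsto_nhds_unique (c.tendsto_P g) ?_
  simp only [← h _, h' _]
  exact c.tendsto_P g'

theorem Rel.add {f g f' g' : H} (h : c.Rel f g) (h' : c.Rel f' g') :
    c.Rel (f + f') (g + g') := fun n => by rw [map_add, map_add, h n, h' n]

theorem Rel.smul {f g : H} (h : c.Rel f g) (a : ℂ) : c.Rel (a • f) (a • g) :=
  fun n => by rw [map_smul, map_smul, h n]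

theorem rel_zero : c.Rel 0 0 := fun n => by simp

theorem isClosed_rel : IsClosed {p : H × H | c.Rel p.1 p.2} := by
  simp only [Rel, Set.ofPred_forall]
  exact isClosed_iInter fun n => isClosed_eq (by fun_prop) (by fun_prop)

theorem tendsto_P_comp {v : ℕ → H} {x : H} (hv : Tendsto v atTop (𝓝 x)) :
    Tendsto (fun n => c.P n (v n)) atTop (𝓝 x) := by
  have h : Tendsto (fun n => c.P n (v n - x)) atTop (𝓝 0) := by
    refine squeeze_zero_norm (a := fun n => ‖v n - x‖) (fun n => ?_) ?_
    · simpa using (c.P n).le_of_opNorm_le (c.norm_P_le n) (v n - x)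
    · simpa using (hv.sub_const x).norm
  simpa [map_sub] using h.add (c.tendsto_P x)

/-- Symmetry of `A`, as the limit of the symmetry of the `A n`. -/
theorem Rel.inner_eq {f g f' g' : H} (h : c.Rel f g) (h' : c.Rel f' g') :
    inner ℂ g f' = inner ℂ f g' := by
  have h1 : Tendsto (fun n => inner ℂ (c.P n g) f') atTop (𝓝 (inner ℂ g f')) :=
    (c.tendsto_P g).inner tendsto_const_nhds
  have h2 : Tendsto (fun n => inner ℂ f (c.P n g')) atTop (𝓝 (inner ℂ f g')) :=
    tendsto_const_nhds.inner (c.tendsto_P g')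
  refine tendsto_nhds_unique h1 (h2.congr fun n => ?_)
  rw [← h n, ← h' n, ← ContinuousLinearMap.adjoint_inner_left, (c.isSelfAdjoint_A n).adjoint_eq]

/-- If `A² ρ` is a bounded operator, then so is `A ρ`. -/
theorem exists_bounded_of_rel_rel {ρ γ : H →L[ℂ] H}
    (h : ∀ x, ∃ y, c.Rel (ρ x) y ∧ c.Rel y (γ x)) :
    ∃ B : H →L[ℂ] H, ∀ x, c.Rel (ρ x) (B x) ∧ c.Rel (B x) (γ x) := by
  choose b hb using h
  let L : H →ₗ[ℂ] H :=
    { toFun := b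
      map_add' := fun x y => (hb (x + y)).1.unique (by
        rw [map_add]; exact (hb x).1.add (hb y).1)
      map_smul' := fun a x => (hb (a • x)).1.unique (by
        rw [map_smul]; exact (hb x).1.smul a) }
  -- Symmetry gives `‖A ρ x‖² = ⟨ρ x, A² ρ x⟩ ≤ t ‖x‖²` with `t = ‖ρ‖ ‖γ‖`; the constant `1 + t`
  -- avoids a square root, as `t ≤ (1 + t)²`.
  refine ⟨L.mkContinuous (1 + ‖ρ‖ * ‖γ‖) fun x => ?_, hb⟩
  have h1 : ‖b x‖ ^ 2 ≤ (‖ρ‖ * ‖γ‖) * ‖x‖ ^ 2 := by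
    have h2 := (hb x).1.inner_eq (hb x).2
    have h3 : ‖b x‖ ^ 2 = RCLike.re (inner ℂ (ρ x) (γ x)) := by
      rw [← h2, inner_self_eq_norm_sq]
    rw [h3]
    calc _ ≤ ‖inner ℂ (ρ x) (γ x)‖ := RCLike.re_le_norm _
      _ ≤ ‖ρ x‖ * ‖γ x‖ := norm_inner_le_norm _ _
      _ ≤ (‖ρ‖ * ‖x‖) * (‖γ‖ * ‖x‖) := by
        gcongr
        · exact ρ.le_opNorm x
        · exact γ.le_opNorm x
      _ = _ := by ring
  have h0 : 0 ≤ ‖ρ‖ * ‖γ‖ := by positivity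
  refine le_of_sq_le_sq ?_ (by positivity)
  refine h1.trans ?_
  rw [mul_pow]
  gcongr
  nlinarith

/-- If `ρ` and `A² ρ` are trace class, then the closure of `A ρ A` is trace class. -/
theorem exists_sandwich {ρ γ : H →L[ℂ] H} (hρ : IsSelfAdjoint ρ) (hρt : besselNorm ρ < ∞)
    (h : ∀ x, ∃ y, c.Rel (ρ x) y ∧ c.Rel y (γ x)) (hγ : besselNorm γ < ∞) :
    ∃ τ : H →L[ℂ] H, (∀ f g, c.Rel f g → c.Rel (ρ g) (τ f)) ∧ besselNorm τ < ∞ := by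
  obtain ⟨B, hB⟩ := exists_bounded_of_rel_rel h
  have hAA : ∀ n, c.A n ∘L c.A n ∘L ρ = c.P n ∘L c.P n ∘L γ := by
    intro n
    ext x
    change c.A n (c.A n (ρ x)) = c.P n (c.P n (γ x))
    rw [(hB x).1 n, c.A_P, (hB x).2 n]
  have hbound : ∀ n, besselNorm (c.A n ∘L ρ ∘L c.A n) ≤ besselNorm γ := by
    intro n
    refine (besselNorm_conj_le hρ (c.isSelfAdjoint_A n) hρt).trans ?_
    rw [hAA]
    exact (besselNorm_comp_left_le (c.norm_P_le n) _).trans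
      (besselNorm_comp_left_le (c.norm_P_le n) _)
  -- The operator on the left is `A n ρ A n`, so its norm is bounded by its trace norm, uniformly in
  -- `n`.
  have hnorm : ∀ n x, ‖c.P n (B (c.A n x))‖ ≤ (besselNorm γ).toReal * ‖x‖ := by
    intro n x
    rw [← (hB _).1 n]
    refine (c.A n ∘L ρ ∘L c.A n).le_of_opNorm_le ?_ x
    have := (enorm_le_besselNorm _).trans (hbound n)
    rw [← ofReal_norm] at this
    exact (ENNReal.ofReal_le_iff_le_toReal hγ.ne).1 this
  let G : Submodule ℂ (H × H) :=
    { carrier := {p | c.Rel p.1 p.2}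
      zero_mem' := rel_zero
      add_mem' := fun hp hq => hp.add hq
      smul_mem' := fun a _ hp => hp.smul a }
  let e : G →ₗ[ℂ] H := LinearMap.fst ℂ H H ∘ₗ G.subtype
  -- `F` is `f ↦ A ρ A f`, written on the graph of `A`. Bounded by `‖f‖` and densely defined, it
  -- extends to `τ`.
  let F : G →ₗ[ℂ] H := (B : H →ₗ[ℂ] H) ∘ₗ LinearMap.snd ℂ H H ∘ₗ G.subtype
  have hd : DenseRange e := fun x =>
    mem_closure_of_tendsto (c.tendsto_P x) (Eventually.of_forall fun n =>
      ⟨⟨(c.P n x, c.A n x), rel_P n x⟩, rfl⟩)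
  have hFe : ∀ p : G, ‖F p‖ ≤ (besselNorm γ).toReal * ‖e p‖ := by
    rintro ⟨⟨f, g⟩, hfg⟩
    have hfg' : c.Rel f g := hfg
    have ht : Tendsto (fun n => c.P n (B (c.A n f))) atTop (𝓝 (B g)) := by
      refine tendsto_P_comp ((B.continuous.tendsto _).comp ?_)
      simpa only [hfg' _] using c.tendsto_P g
    exact le_of_tendsto ht.norm (Eventually.of_forall fun n => hnorm n f)
  have hτ : ∀ f g, c.Rel f g → F.extendOfNorm e f = B g := fun f g hfg =>
    LinearMap.extendOfNorm_eq hd ⟨_, hFe⟩ ⟨(f, g), hfg⟩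
  refine ⟨F.extendOfNorm e, fun f g hfg => ?_, ?_⟩
  · rw [hτ f g hfg]
    exact (hB g).1
  -- `A n ρ A n = P n τ P n` converges strongly to `τ`, so the uniform trace norm bound passes to
  -- `τ`.
  · refine (besselNorm_le_of_tendsto (T := fun n => c.A n ∘L ρ ∘L c.A n) (fun x => ?_)
      (Eventually.of_forall hbound)).trans_lt hγ
    have h1 : ∀ n, (c.A n ∘L ρ ∘L c.A n) x = c.P n (F.extendOfNorm e (c.P n x)) := by
      intro n
      rw [hτ _ _ (rel_P n x)]
      exact (hB _).1 n
    simp only [h1]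
    exact tendsto_P_comp (((F.extendOfNorm e).continuous.tendsto _).comp (c.tendsto_P x))

theorem isSelfAdjoint_compression {ρ : H →L[ℂ] H} (hρ : IsSelfAdjoint ρ) (n : ℕ) :
    IsSelfAdjoint (c.P n ∘L ρ ∘L c.P n) := by
  have := hρ.conjugate (c.P n)
  rwa [(c.isSelfAdjoint_P n).star_eq] at this

theorem rel_A (n : ℕ) (f : H) : c.Rel (c.A n f) (c.A n (c.A n f)) := by
  conv => arg 2; rw [← c.P_A]
  exact rel_P n _

theorem rel_compression {ρ τ : H →L[ℂ] H} (h : ∀ f g, c.Rel f g → c.Rel (ρ g) (τ f)) (n : ℕ)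
    {f g : H} (hfg : c.Rel f g) :
    c.Rel ((c.P n ∘L ρ ∘L c.P n) g) ((c.P n ∘L τ ∘L c.P n) f) := by
  change c.Rel (c.P n (ρ (c.P n g))) (c.P n (τ (c.P n f)))
  rw [← hfg n, ← h _ _ (rel_P n f) n]
  exact rel_P n _

end Cutoff

end Cutoff

/-! ### Bounded Fourier multipliers on `L²(ℝ³)` -/

section FourierMultiplier

open FourierTransform

theorem L2_ext_fourier {f g : L2} (h : ∀ᵐ ξ, (𝓕 f : L2) ξ = (𝓕 g : L2) ξ) : f = g :=
  (Lp.fourierTransformₗᵢ (EuclideanSpace ℝ (Fin 3)) ℂ).injective (Lp.ext h)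

variable {φ ψ : EuclideanSpace ℝ (Fin 3) → ℝ} {C : ℝ}

theorem memLp_mul_of_bounded (hφ : Measurable φ) (hC : ∀ ξ, |φ ξ| ≤ C) (f : L2) :
    MemLp (fun ξ => (φ ξ : ℂ) * f ξ) 2 volume := by
  refine MemLp.of_le_mul (c := C) (Lp.memLp f)
    ((Complex.measurable_ofReal.comp hφ).aestronglyMeasurable.mul (Lp.memLp f).1) ?_
  filter_upwards with ξ
  rw [norm_mul, Complex.norm_real, Real.norm_eq_abs]
  exact mul_le_mul_of_nonneg_right (hC ξ) (norm_nonneg _)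

/-- Multiplication by a bounded real function. -/
def mulOp (hφ : Measurable φ) (hC : ∀ ξ, |φ ξ| ≤ C) : L2 →L[ℂ] L2 :=
  LinearMap.mkContinuous
    { toFun := fun f => (memLp_mul_of_bounded hφ hC f).toLp _
      map_add' := fun f g => by
        refine Lp.ext ?_
        filter_upwards [(memLp_mul_of_bounded hφ hC (f + g)).coeFn_toLp,
          (memLp_mul_of_bounded hφ hC f).coeFn_toLp, (memLp_mul_of_bounded hφ hC g).coeFn_toLp,
          Lp.coeFn_add f g, Lp.coeFn_add ((memLp_mul_of_bounded hφ hC f).toLp _)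
            ((memLp_mul_of_bounded hφ hC g).toLp _)] with ξ h1 h2 h3 h4 h5
        rw [h1, h5, Pi.add_apply, h2, h3, h4, Pi.add_apply, mul_add]
      map_smul' := fun a f => by
        refine Lp.ext ?_
        filter_upwards [(memLp_mul_of_bounded hφ hC (a • f)).coeFn_toLp,
          (memLp_mul_of_bounded hφ hC f).coeFn_toLp, Lp.coeFn_smul a f,
          Lp.coeFn_smul a ((memLp_mul_of_bounded hφ hC f).toLp _)] with ξ h1 h2 h3 h4
        rw [h1, RingHom.id_apply, h4, Pi.smul_apply, h2, h3, Pi.smul_apply, smul_eq_mul,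
          smul_eq_mul, mul_left_comm] }
    C fun f => by
      refine Lp.norm_le_mul_norm_of_ae_le_mul ?_
      filter_upwards [(memLp_mul_of_bounded hφ hC f).coeFn_toLp] with ξ h1
      change ‖((memLp_mul_of_bounded hφ hC f).toLp _ : L2) ξ‖ ≤ _
      rw [h1, norm_mul, Complex.norm_real, Real.norm_eq_abs]
      exact mul_le_mul_of_nonneg_right (hC ξ) (norm_nonneg _)

theorem coeFn_mulOp (hφ : Measurable φ) (hC : ∀ ξ, |φ ξ| ≤ C) (f : L2) :
    ∀ᵐ ξ, mulOp hφ hC f ξ = φ ξ * f ξ :=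
  (memLp_mul_of_bounded hφ hC f).coeFn_toLp

/-- The operator with the bounded real symbol `φ`. -/
def fourierOp (hφ : Measurable φ) (hC : ∀ ξ, |φ ξ| ≤ C) : L2 →L[ℂ] L2 :=
  ((Lp.fourierTransformₗᵢ (EuclideanSpace ℝ (Fin 3)) ℂ).symm.toContinuousLinearEquiv :
    L2 →L[ℂ] L2) ∘L mulOp hφ hC ∘L
    ((Lp.fourierTransformₗᵢ (EuclideanSpace ℝ (Fin 3)) ℂ).toContinuousLinearEquiv : L2 →L[ℂ] L2)

theorem fourier_fourierOp (hφ : Measurable φ) (hC : ∀ ξ, |φ ξ| ≤ C) (f : L2) :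
    (𝓕 (fourierOp hφ hC f) : L2) = mulOp hφ hC (𝓕 f) :=
  (Lp.fourierTransformₗᵢ (EuclideanSpace ℝ (Fin 3)) ℂ).apply_symm_apply _

theorem coeFn_fourier_fourierOp (hφ : Measurable φ) (hC : ∀ ξ, |φ ξ| ≤ C) (f : L2) :
    ∀ᵐ ξ, (𝓕 (fourierOp hφ hC f) : L2) ξ = φ ξ * (𝓕 f : L2) ξ := by
  rw [fourier_fourierOp]
  exact coeFn_mulOp hφ hC _

theorem norm_fourierOp_le (hφ : Measurable φ) (hC : ∀ ξ, |φ ξ| ≤ C) (hC0 : 0 ≤ C) :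
    ‖fourierOp hφ hC‖ ≤ C := by
  refine ContinuousLinearMap.opNorm_le_bound _ hC0 fun f => ?_
  rw [← Lp.norm_fourier_eq, fourier_fourierOp, ← Lp.norm_fourier_eq f]
  exact (mulOp hφ hC).le_of_opNorm_le (LinearMap.mkContinuous_norm_le _ hC0 _) _

theorem isSelfAdjoint_fourierOp (hφ : Measurable φ) (hC : ∀ ξ, |φ ξ| ≤ C) :
    IsSelfAdjoint (fourierOp hφ hC) := by
  rw [ContinuousLinearMap.isSelfAdjoint_iff_isSymmetric]
  intro f g
  change inner ℂ (fourierOp hφ hC f) g = inner ℂ f (fourierOp hφ hC g)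
  rw [← Lp.inner_fourier_eq, ← Lp.inner_fourier_eq f, L2.inner_def, L2.inner_def]
  refine integral_congr_ae ?_
  filter_upwards [coeFn_fourier_fourierOp hφ hC f, coeFn_fourier_fourierOp hφ hC g] with ξ h1 h2
  rw [h1, h2, RCLike.inner_apply, RCLike.inner_apply, map_mul, Complex.conj_ofReal]
  ring

/-- Plancherel and dominated convergence, with majorant `4 |𝓕 f|²`. -/
theorem tendsto_of_fourier_dominated {F : ℕ → L2} {f : L2}
    (hb : ∀ n, ∀ᵐ ξ, ‖(𝓕 (F n) : L2) ξ‖ ≤ ‖(𝓕 f : L2) ξ‖)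
    (hF : ∀ᵐ ξ, ∀ᶠ n in atTop, (𝓕 (F n) : L2) ξ = (𝓕 f : L2) ξ) :
    Tendsto F atTop (𝓝 f) := by
  rw [tendsto_iff_norm_sub_tendsto_zero]
  have hsub : ∀ n, ‖F n - f‖ ^ 2 = ∫ ξ, ‖(𝓕 (F n) : L2) ξ - (𝓕 f : L2) ξ‖ ^ 2 := by
    intro n
    have h1 : (𝓕 (F n - f) : L2) = 𝓕 (F n) - 𝓕 f :=
      map_sub (Lp.fourierTransformₗᵢ (EuclideanSpace ℝ (Fin 3)) ℂ) _ _
    rw [← Lp.norm_fourier_eq, h1, ← inner_self_eq_norm_sq (𝕜 := ℂ), L2.inner_def, ← integral_re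
      (L2.integrable_inner _ _)]
    refine integral_congr_ae ?_
    filter_upwards [Lp.coeFn_sub (𝓕 (F n) : L2) (𝓕 f)] with ξ h2
    rw [inner_self_eq_norm_sq, h2, Pi.sub_apply]
  have hint : Integrable (fun ξ => 4 * ‖(𝓕 f : L2) ξ‖ ^ 2) volume :=
    ((memLp_two_iff_integrable_sq_norm (Lp.memLp (𝓕 f : L2)).1).1 (Lp.memLp _)).const_mul 4
  have hlim := tendsto_integral_of_dominated_convergence
    (F := fun n ξ => ‖(𝓕 (F n) : L2) ξ - (𝓕 f : L2) ξ‖ ^ 2) (f := fun _ => (0 : ℝ)) _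
    (fun n => (((Lp.memLp (𝓕 (F n) : L2)).1.sub (Lp.memLp (𝓕 f : L2)).1).norm.pow 2)) hint
    (fun n => by
      filter_upwards [hb n] with ξ h1
      rw [Real.norm_of_nonneg (by positivity)]
      have h2 := norm_sub_le ((𝓕 (F n) : L2) ξ) ((𝓕 f : L2) ξ)
      calc ‖(𝓕 (F n) : L2) ξ - (𝓕 f : L2) ξ‖ ^ 2 ≤ (2 * ‖(𝓕 f : L2) ξ‖) ^ 2 :=
            pow_le_pow_left₀ (norm_nonneg _) (by linarith) 2
        _ = _ := by ring)
    (by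
      filter_upwards [hF] with ξ h1
      refine tendsto_const_nhds.congr' ?_
      filter_upwards [h1] with n h2
      simp [h2])
  simp only [← hsub, integral_zero] at hlim
  have := hlim.sqrt
  simpa [Real.sqrt_sq] using this

end FourierMultiplier

/-! ### Momentum cutoffs of `H₀^{1/2}` -/

section FreeHamiltonian

open FourierTransform

/-- The symbol of `H₀^{1/2}`. -/
def sqrtSymbol (ξ : EuclideanSpace ℝ (Fin 3)) : ℝ := 2 * Real.pi * ‖ξ‖ / Real.sqrt 2

theorem measurable_indicator_closedBall {φ : EuclideanSpace ℝ (Fin 3) → ℝ} (hφ : Measurable φ)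
    (n : ℕ) : Measurable ((Metric.closedBall 0 (n : ℝ)).indicator φ) :=
  hφ.indicator Metric.isClosed_closedBall.measurableSet

theorem measurable_sqrtSymbol : Measurable sqrtSymbol := by unfold sqrtSymbol; fun_prop

theorem abs_indicator_one_le (n : ℕ) (ξ : EuclideanSpace ℝ (Fin 3)) :
    |(Metric.closedBall 0 (n : ℝ)).indicator (fun _ => (1 : ℝ)) ξ| ≤ 1 := by
  by_cases h : ξ ∈ Metric.closedBall (0 : EuclideanSpace ℝ (Fin 3)) (n : ℝ) <;> simp [h]

theorem abs_indicator_sqrtSymbol_le (n : ℕ) (ξ : EuclideanSpace ℝ (Fin 3)) :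
    |(Metric.closedBall 0 (n : ℝ)).indicator sqrtSymbol ξ| ≤ 2 * Real.pi * n / Real.sqrt 2 := by
  by_cases h : ξ ∈ Metric.closedBall (0 : EuclideanSpace ℝ (Fin 3)) (n : ℝ)
  · rw [Set.indicator_of_mem h, sqrtSymbol, abs_of_nonneg (by positivity)]
    have : ‖ξ‖ ≤ n := by simpa using h
    gcongr
  · rw [Set.indicator_of_notMem h, abs_zero]
    positivity

theorem eventually_mem_closedBall (ξ : EuclideanSpace ℝ (Fin 3)) :
    ∀ᶠ n : ℕ in atTop, ξ ∈ Metric.closedBall (0 : EuclideanSpace ℝ (Fin 3)) (n : ℝ) := by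
  obtain ⟨N, hN⟩ := exists_nat_ge ‖ξ‖
  filter_upwards [eventually_ge_atTop N] with n hn
  rw [mem_closedBall_zero_iff]
  exact hN.trans (by exact_mod_cast hn)

/-- The momentum cutoffs of `H₀^{1/2}`. -/
def freeCutoff : Cutoff L2 where
  P n := fourierOp (measurable_indicator_closedBall measurable_const n) (abs_indicator_one_le n)
  A n := fourierOp (measurable_indicator_closedBall measurable_sqrtSymbol n)
    (abs_indicator_sqrtSymbol_le n)
  isSelfAdjoint_P n := isSelfAdjoint_fourierOp _ _
  isSelfAdjoint_A n := isSelfAdjoint_fourierOp _ _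
  norm_P_le n := norm_fourierOp_le _ _ zero_le_one
  tendsto_P f := by
    refine tendsto_of_fourier_dominated (fun n => ?_) ?_
    · filter_upwards [coeFn_fourier_fourierOp (measurable_indicator_closedBall measurable_const n)
        (abs_indicator_one_le n) f] with ξ h
      rw [h, norm_mul, Complex.norm_real, Real.norm_eq_abs]
      exact mul_le_of_le_one_left (norm_nonneg _) (abs_indicator_one_le n ξ)
    · have h := ae_all_iff.2 fun n : ℕ => coeFn_fourier_fourierOp
        (measurable_indicator_closedBall measurable_const n) (abs_indicator_one_le n) f
      filter_upwards [h] with ξ h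
      filter_upwards [eventually_mem_closedBall ξ] with n hn
      rw [h n, Set.indicator_of_mem hn, Complex.ofReal_one, one_mul]
  A_P m n f := by
    refine L2_ext_fourier ?_
    filter_upwards [coeFn_fourier_fourierOp
        (measurable_indicator_closedBall measurable_const m) (abs_indicator_one_le m) f,
      coeFn_fourier_fourierOp (measurable_indicator_closedBall measurable_sqrtSymbol m)
        (abs_indicator_sqrtSymbol_le m) f,
      coeFn_fourier_fourierOp (measurable_indicator_closedBall measurable_const n)
        (abs_indicator_one_le n) (fourierOp (measurable_indicator_closedBall
        measurable_sqrtSymbol m) (abs_indicator_sqrtSymbol_le m) f),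
      coeFn_fourier_fourierOp (measurable_indicator_closedBall measurable_sqrtSymbol n)
        (abs_indicator_sqrtSymbol_le n) (fourierOp (measurable_indicator_closedBall measurable_const
        m) (abs_indicator_one_le m) f)] with ξ h1 h2 h3 h4
    rw [h3, h4, h1, h2]
    by_cases hn : ξ ∈ Metric.closedBall (0 : EuclideanSpace ℝ (Fin 3)) (n : ℝ) <;>
      by_cases hm : ξ ∈ Metric.closedBall (0 : EuclideanSpace ℝ (Fin 3)) (m : ℝ) <;>
      simp [Set.indicator, hn, hm]
  P_A n f := by
    refine L2_ext_fourier ?_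
    filter_upwards [coeFn_fourier_fourierOp
        (measurable_indicator_closedBall measurable_sqrtSymbol n) (abs_indicator_sqrtSymbol_le n) f,
      coeFn_fourier_fourierOp (measurable_indicator_closedBall measurable_const n)
        (abs_indicator_one_le n) (fourierOp (measurable_indicator_closedBall
        measurable_sqrtSymbol n) (abs_indicator_sqrtSymbol_le n) f)] with ξ h1 h2
    rw [h2, h1]
    by_cases hn : ξ ∈ Metric.closedBall (0 : EuclideanSpace ℝ (Fin 3)) (n : ℝ) <;>
      simp [Set.indicator, hn]

theorem mem_sqrtFreeHamiltonianGraph_iff_rel (f g : L2) :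
    (f, g) ∈ sqrtFreeHamiltonianGraph ↔ freeCutoff.Rel f g := by
  have hA := ae_all_iff.2 fun n : ℕ => coeFn_fourier_fourierOp
    (measurable_indicator_closedBall measurable_sqrtSymbol n) (abs_indicator_sqrtSymbol_le n) f
  have hP := ae_all_iff.2 fun n : ℕ => coeFn_fourier_fourierOp
    (measurable_indicator_closedBall measurable_const n) (abs_indicator_one_le n) g
  constructor
  · intro h n
    refine L2_ext_fourier ?_
    have h' : ∀ᵐ ξ, (𝓕 g : L2) ξ = (sqrtSymbol ξ : ℂ) * (𝓕 f : L2) ξ := h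
    filter_upwards [h', hA, hP] with ξ h1 h2 h3
    refine (h2 n).trans (Eq.trans ?_ (h3 n).symm)
    by_cases hn : ξ ∈ Metric.closedBall (0 : EuclideanSpace ℝ (Fin 3)) (n : ℝ) <;>
      simp [hn, h1]
  · intro h
    change ∀ᵐ ξ, (𝓕 g : L2) ξ = (sqrtSymbol ξ : ℂ) * (𝓕 f : L2) ξ
    filter_upwards [hA, hP] with ξ h2 h3
    -- At each `ξ`, one cutoff whose ball contains `ξ` already gives the symbol identity.
    obtain ⟨n, hn⟩ := (eventually_mem_closedBall ξ).exists
    have h5 : (𝓕 (freeCutoff.A n f) : L2) ξ = (𝓕 (freeCutoff.P n g) : L2) ξ := by rw [h n]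
    have h6 := (h2 n).symm.trans (h5.trans (h3 n))
    simpa [hn] using h6.symm

theorem mem_graph_sqrtFreeHamiltonian_iff (f g : L2) :
    (f, g) ∈ sqrtFreeHamiltonian.graph ↔ freeCutoff.Rel f g := by
  rw [graph_sqrtFreeHamiltonian, mem_sqrtFreeHamiltonianGraph_iff_rel]

theorem mem_graph_freeHamiltonian_iff (f h : L2) :
    (f, h) ∈ freeHamiltonian.graph ↔ ∃ g, freeCutoff.Rel f g ∧ freeCutoff.Rel g h := by
  rw [graph_freeHamiltonian, mem_freeHamiltonianGraph_iff_sqrt]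
  simp only [mem_sqrtFreeHamiltonianGraph_iff_rel]

end FreeHamiltonian

/-! ### Graphs of partially defined operators -/

section PartialMaps

variable {H : Type*} [NormedAddCommGroup H] [InnerProductSpace ℂ H]

theorem mem_graph_toPMap_top_iff (γ : H →L[ℂ] H) (x y : H) :
    (x, y) ∈ ((γ : H →ₗ[ℂ] H).toPMap ⊤).graph ↔ γ x = y := by
  rw [LinearPMap.mem_graph_iff]
  constructor
  · rintro ⟨z, h1, h2⟩
    change (z : H) = x at h1
    change γ z = y at h2
    rw [← h1, h2]
  · rintro rfl
    exact ⟨⟨x, trivial⟩, rfl, rfl⟩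

theorem mem_graph_compPMap_iff (ρ : H →L[ℂ] H) (T : H →ₗ.[ℂ] H) (x z : H) :
    (x, z) ∈ ((ρ : H →ₗ[ℂ] H).compPMap T).graph ↔ ∃ y, (x, y) ∈ T.graph ∧ ρ y = z := by
  simp only [LinearPMap.mem_graph_iff]
  constructor
  · rintro ⟨w, h1, h2⟩
    exact ⟨T w, ⟨w, h1, rfl⟩, h2⟩
  · rintro ⟨y, ⟨w, h1, h2⟩, h3⟩
    refine ⟨w, h1, ?_⟩
    change T w = y at h2
    change ρ (T w) = z
    rw [h2, h3]

theorem mem_graph_pcomp_iff (S T : H →ₗ.[ℂ] H) (x z : H) :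
    (x, z) ∈ (pcomp S T).graph ↔ ∃ y, (x, y) ∈ T.graph ∧ (y, z) ∈ S.graph := by
  simp only [LinearPMap.mem_graph_iff]
  constructor
  · rintro ⟨⟨w, hw, hw'⟩, h1, h2⟩
    obtain ⟨v, hv, rfl⟩ := hw
    exact ⟨T v, ⟨v, h1, rfl⟩, ⟨T v, hv⟩, rfl, h2⟩
  · rintro ⟨y, ⟨v, h1, h2⟩, ⟨u, h3, h4⟩⟩
    change T v = y at h2
    change (u : H) = y at h3
    change S u = z at h4
    have hv : v ∈ S.domain.comap T.toFun := by
      change T v ∈ S.domain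
      rw [h2, ← h3]
      exact u.2
    refine ⟨⟨v, ⟨v, hv, rfl⟩, v.2⟩, h1, ?_⟩
    rw [← h4]
    have hu : (⟨T v, hv⟩ : S.domain) = u := Subtype.ext (h2.trans h3.symm)
    rw [← hu]
    rfl

theorem toPMap_top_injective {γ γ' : H →L[ℂ] H}
    (h : (γ : H →ₗ[ℂ] H).toPMap ⊤ = (γ' : H →ₗ[ℂ] H).toPMap ⊤) : γ = γ' := by
  ext x
  have h1 := (mem_graph_toPMap_top_iff γ x _).2 rfl
  rw [h] at h1
  exact ((mem_graph_toPMap_top_iff γ' x _).1 h1).symm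

variable [CompleteSpace H]

theorem pTraceNorm_toPMap_top (γ : H →L[ℂ] H) :
    pTraceNorm ((γ : H →ₗ[ℂ] H).toPMap ⊤) = besselNorm γ := by
  rw [← traceNorm_eq_besselNorm]
  refine le_antisymm (iInf_le_of_le γ (iInf_le_of_le rfl le_rfl)) (le_iInf₂ fun γ' h => ?_)
  rw [toPMap_top_injective h]

theorem exists_of_pTraceNorm_lt_top {T : H →ₗ.[ℂ] H} (h : pTraceNorm T < ∞) :
    ∃ γ : H →L[ℂ] H, T = (γ : H →ₗ[ℂ] H).toPMap ⊤ ∧ besselNorm γ < ∞ := by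
  obtain ⟨γ, h⟩ := iInf_lt_iff.1 h
  obtain ⟨h1, h2⟩ := iInf_lt_iff.1 h
  exact ⟨γ, h1, by rwa [← traceNorm_eq_besselNorm]⟩

end PartialMaps

/-! ### The spaces `Z` and `Y` -/

section Spaces

theorem mem_graph_sandwich_iff (ρ : L2 →L[ℂ] L2) (f h : L2) :
    (f, h) ∈ (sandwich ρ).graph ↔ ∃ g, freeCutoff.Rel f g ∧ freeCutoff.Rel (ρ g) h := by
  simp only [sandwich, mem_graph_pcomp_iff, mem_graph_compPMap_iff,
    mem_graph_sqrtFreeHamiltonian_iff]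
  constructor
  · rintro ⟨_, ⟨g, h1, rfl⟩, h2⟩
    exact ⟨g, h1, h2⟩
  · rintro ⟨g, h1, h2⟩
    exact ⟨_, ⟨g, h1, rfl⟩, h2⟩

theorem mem_graph_leftProd_iff (ρ : L2 →L[ℂ] L2) (f h : L2) :
    (f, h) ∈ (leftProd ρ).graph ↔
      ∃ g, freeCutoff.Rel (ρ f) g ∧ freeCutoff.Rel g h := by
  simp only [leftProd, mem_graph_pcomp_iff, mem_graph_toPMap_top_iff,
    mem_graph_freeHamiltonian_iff, exists_eq_left']

/-- `τ` is the closure of `H₀^{1/2} ρ H₀^{1/2}`, which is defined on the domain of `H₀^{1/2}`. -/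
def IsSandwich (ρ τ : L2 →L[ℂ] L2) : Prop :=
  ∀ f g, freeCutoff.Rel f g → freeCutoff.Rel (ρ g) (τ f)

/-- `γ` is the product `H₀ ρ`. -/
def IsLeftProd (ρ γ : L2 →L[ℂ] L2) : Prop :=
  ∀ f, ∃ g, freeCutoff.Rel (ρ f) g ∧ freeCutoff.Rel g (γ f)

theorem IsSandwich.closure_eq {ρ τ : L2 →L[ℂ] L2} (h : IsSandwich ρ τ) :
    (sandwich ρ).closure = (τ : L2 →ₗ[ℂ] L2).toPMap ⊤ := by
  have hle : sandwich ρ ≤ (τ : L2 →ₗ[ℂ] L2).toPMap ⊤ := by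
    refine LinearPMap.le_of_le_graph ?_
    rintro ⟨f, k⟩ hf
    obtain ⟨g, h1, h2⟩ := (mem_graph_sandwich_iff ρ f k).1 hf
    exact (mem_graph_toPMap_top_iff τ f k).2 ((h f g h1).unique h2)
  have hcl : ((τ : L2 →ₗ[ℂ] L2).toPMap ⊤).IsClosed := by
    have : ((((τ : L2 →ₗ[ℂ] L2).toPMap ⊤).graph : Submodule ℂ (L2 × L2)) : Set (L2 × L2)) =
        {p | τ p.1 = p.2} := by
      ext ⟨x, y⟩
      exact mem_graph_toPMap_top_iff τ x y
    rw [LinearPMap.IsClosed, this]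
    exact isClosed_eq (by fun_prop) (by fun_prop)
  have hc : (sandwich ρ).IsClosable := hcl.isClosable.leIsClosable hle
  refine LinearPMap.eq_of_eq_graph (le_antisymm ?_ ?_)
  · rw [← hc.graph_closure_eq_closure_graph]
    exact Submodule.topologicalClosure_minimal _ (LinearPMap.le_graph_of_le hle) hcl
  · rw [← hc.graph_closure_eq_closure_graph]
    -- `P n f` lies in the domain of `H₀^{1/2}` and tends to `f`, so by continuity of `τ` its graph
    -- is the closure of that of the sandwich.
    rintro ⟨f, k⟩ hf
    obtain rfl := (mem_graph_toPMap_top_iff τ f k).1 hf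
    have ht : Tendsto (fun n => (freeCutoff.P n f, τ (freeCutoff.P n f))) atTop (𝓝 (f, τ f)) :=
      (freeCutoff.tendsto_P f).prodMk_nhds ((τ.continuous.tendsto f).comp (freeCutoff.tendsto_P f))
    refine mem_closure_of_tendsto ht (Eventually.of_forall fun n => ?_)
    exact (mem_graph_sandwich_iff ρ _ _).2
      ⟨_, Cutoff.rel_P n f, h _ _ (Cutoff.rel_P n f)⟩

theorem IsLeftProd.leftProd_eq {ρ γ : L2 →L[ℂ] L2} (h : IsLeftProd ρ γ) :
    leftProd ρ = (γ : L2 →ₗ[ℂ] L2).toPMap ⊤ := by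
  refine LinearPMap.eq_of_eq_graph (SetLike.ext ?_)
  rintro ⟨f, k⟩
  rw [mem_graph_leftProd_iff, mem_graph_toPMap_top_iff]
  obtain ⟨g, h1, h2⟩ := h f
  constructor
  · rintro ⟨g', h3, h4⟩
    rw [← h1.unique h3] at h4
    exact h2.unique h4
  · rintro rfl
    exact ⟨g, h1, h2⟩

theorem IsSandwich.domain_le {ρ τ : L2 →L[ℂ] L2} (h : IsSandwich ρ τ) :
    sqrtFreeHamiltonian.domain ≤ (sandwich ρ).domain := by
  intro f hf
  obtain ⟨g, hg⟩ := LinearPMap.mem_domain_iff.1 hf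
  rw [mem_graph_sqrtFreeHamiltonian_iff] at hg
  exact LinearPMap.mem_domain_iff.2 ⟨τ f, (mem_graph_sandwich_iff ρ _ _).2 ⟨g, hg, h f g hg⟩⟩

theorem mem_Z_iff (ρ : L2 →L[ℂ] L2) : ρ ∈ Z ↔
    ∃ τ, (IsSelfAdjoint ρ ∧ IsSandwich ρ τ) ∧ besselNorm ρ < ∞ ∧ besselNorm τ < ∞ := by
  constructor
  · rintro ⟨h1, h2, h3, h4⟩
    obtain ⟨τ, h5, h6⟩ := exists_of_pTraceNorm_lt_top h4
    refine ⟨τ, ⟨h1, fun f g hfg => ?_⟩, by rwa [← traceNorm_eq_besselNorm], h6⟩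
    -- The domain condition in `Z` enters here: that the closure is everywhere defined does not by
    -- itself put `f` in the domain of the unclosed product.
    have hf : f ∈ (sandwich ρ).domain := h3 (LinearPMap.mem_domain_of_mem_graph
      ((mem_graph_sqrtFreeHamiltonian_iff f g).2 hfg))
    obtain ⟨k, hk⟩ := LinearPMap.mem_domain_iff.1 hf
    have hk' := LinearPMap.le_graph_of_le (LinearPMap.le_closure (sandwich ρ)) hk
    rw [h5, mem_graph_toPMap_top_iff] at hk'
    obtain ⟨g', h7, h8⟩ := (mem_graph_sandwich_iff ρ f k).1 hk
    rwa [hfg.unique h7, hk']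
  · rintro ⟨τ, ⟨h1, h2⟩, h3, h4⟩
    refine ⟨h1, by rwa [traceNorm_eq_besselNorm], h2.domain_le, ?_⟩
    rwa [h2.closure_eq, pTraceNorm_toPMap_top]

theorem normZ_eq {ρ τ : L2 →L[ℂ] L2} (h : IsSandwich ρ τ) :
    normZ ρ = (besselNorm ρ + besselNorm τ).toReal := by
  rw [normZ, h.closure_eq, pTraceNorm_toPMap_top, traceNorm_eq_besselNorm]

theorem mem_Y_iff (ρ : L2 →L[ℂ] L2) : ρ ∈ Y ↔
    ∃ γ, (IsSelfAdjoint ρ ∧ IsLeftProd ρ γ) ∧ besselNorm ρ < ∞ ∧ besselNorm γ < ∞ := by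
  constructor
  · rintro ⟨h1, h2, h4⟩
    obtain ⟨γ, h5, h6⟩ := exists_of_pTraceNorm_lt_top h4
    refine ⟨γ, ⟨h1, fun f => ?_⟩, by rwa [← traceNorm_eq_besselNorm], h6⟩
    rw [← mem_graph_leftProd_iff, h5, mem_graph_toPMap_top_iff]
  · rintro ⟨γ, ⟨h1, h2⟩, h3, h4⟩
    refine ⟨h1, by rwa [traceNorm_eq_besselNorm], ?_⟩
    rwa [h2.leftProd_eq, pTraceNorm_toPMap_top]

theorem normY_eq {ρ γ : L2 →L[ℂ] L2} (h : IsLeftProd ρ γ) :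
    normY ρ = (besselNorm ρ + besselNorm γ).toReal := by
  rw [normY, h.leftProd_eq, pTraceNorm_toPMap_top, traceNorm_eq_besselNorm]

theorem Y_subset_Z : Y ⊆ Z := by
  intro ρ hρ
  obtain ⟨γ, ⟨h1, h2⟩, h3, h4⟩ := (mem_Y_iff ρ).1 hρ
  obtain ⟨τ, h5, h6⟩ := Cutoff.exists_sandwich h1 h3 h2 h4
  exact (mem_Z_iff ρ).2 ⟨τ, ⟨h1, h5⟩, h3, h6⟩

theorem real_smul_eq (c : ℝ) (T : L2 →L[ℂ] L2) : c • T = (c : ℂ) • T := by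
  ext1 f
  refine Lp.ext ?_
  filter_upwards [Lp.coeFn_smul c (T f), Lp.coeFn_smul (c : ℂ) (T f)] with ξ h1 h2
  refine h1.trans (Eq.trans ?_ h2.symm)
  simp

theorem isDominatingNorm_besselNorm :
    IsDominatingNorm (besselNorm : (L2 →L[ℂ] L2) → ℝ≥0∞) where
  add_le := besselNorm_add_le
  smul_le c T := by
    rw [real_smul_eq]
    refine (besselNorm_smul_le _ _).trans (le_of_eq ?_)
    rw [← ofReal_norm, ← ofReal_norm, Complex.norm_real]
  enorm_le := enorm_le_besselNorm
  le_of_tendsto v T C hv hC := besselNorm_le_of_tendsto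
    (fun x => ((ContinuousLinearMap.apply ℂ L2 x).continuous.tendsto T).comp hv) hC

theorem isSelfAdjoint_real_smul {ρ : L2 →L[ℂ] L2} (h : IsSelfAdjoint ρ) (c : ℝ) :
    IsSelfAdjoint (c • ρ) := by
  rw [real_smul_eq]
  exact IsSelfAdjoint.smul (Complex.conj_ofReal c) h

theorem isClosed_isSelfAdjoint : IsClosed {ρ : L2 →L[ℂ] L2 | IsSelfAdjoint ρ} :=
  isClosed_eq continuous_star continuous_id

/-- The pairs of a Hermitian `ρ` and the closure of `H₀^{1/2} ρ H₀^{1/2}`. -/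
def sandwichPairs : Submodule ℝ ((L2 →L[ℂ] L2) × (L2 →L[ℂ] L2)) where
  carrier := {p | IsSelfAdjoint p.1 ∧ IsSandwich p.1 p.2}
  zero_mem' := ⟨IsSelfAdjoint.zero _, fun _ _ _ => Cutoff.rel_zero⟩
  add_mem' hp hq := ⟨hp.1.add hq.1, fun f g hfg => (hp.2 f g hfg).add (hq.2 f g hfg)⟩
  smul_mem' c p hp := by
    refine ⟨isSelfAdjoint_real_smul hp.1 c, fun f g hfg => ?_⟩
    rw [Prod.smul_fst, Prod.smul_snd, real_smul_eq, real_smul_eq]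
    exact (hp.2 f g hfg).smul _

theorem isClosed_sandwichPairs :
    IsClosed (sandwichPairs : Set ((L2 →L[ℂ] L2) × (L2 →L[ℂ] L2))) := by
  have h : (sandwichPairs : Set ((L2 →L[ℂ] L2) × (L2 →L[ℂ] L2))) =
      {p | IsSelfAdjoint p.1} ∩ ⋂ (f : L2) (g : L2) (_ : freeCutoff.Rel f g),
        (fun p : (L2 →L[ℂ] L2) × (L2 →L[ℂ] L2) => (p.1 g, p.2 f)) ⁻¹'
          {q | freeCutoff.Rel q.1 q.2} := by
    ext p
    simp [sandwichPairs, IsSandwich]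
  rw [h]
  exact (isClosed_isSelfAdjoint.preimage continuous_fst).inter
    (isClosed_iInter fun f => isClosed_iInter fun g => isClosed_iInter fun _ =>
      Cutoff.isClosed_rel.preimage (by fun_prop))

/-- The pairs of a Hermitian `ρ` and `H₀ ρ`. -/
def leftProdPairs : Submodule ℝ ((L2 →L[ℂ] L2) × (L2 →L[ℂ] L2)) where
  carrier := {p | IsSelfAdjoint p.1 ∧ IsLeftProd p.1 p.2}
  zero_mem' := ⟨IsSelfAdjoint.zero _, fun _ => ⟨0, Cutoff.rel_zero, Cutoff.rel_zero⟩⟩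
  add_mem' {p q} hp hq := by
    refine ⟨hp.1.add hq.1, fun f => ?_⟩
    obtain ⟨g, h1, h2⟩ := hp.2 f
    obtain ⟨g', h3, h4⟩ := hq.2 f
    exact ⟨g + g', h1.add h3, h2.add h4⟩
  smul_mem' c p hp := by
    refine ⟨isSelfAdjoint_real_smul hp.1 c, fun f => ?_⟩
    rw [Prod.smul_fst, Prod.smul_snd, real_smul_eq, real_smul_eq]
    obtain ⟨g, h1, h2⟩ := hp.2 f
    exact ⟨(c : ℂ) • g, h1.smul _, h2.smul _⟩

/-- The graph of `H₀` is closed. -/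
theorem isClosed_rel_rel :
    IsClosed {p : L2 × L2 | ∃ g, freeCutoff.Rel p.1 g ∧ freeCutoff.Rel g p.2} := by
  have h : {p : L2 × L2 | ∃ g, freeCutoff.Rel p.1 g ∧ freeCutoff.Rel g p.2} =
      (freeHamiltonianGraph : Set (L2 × L2)) := by
    ext ⟨f, k⟩
    rw [← graph_freeHamiltonian]
    exact (mem_graph_freeHamiltonian_iff f k).symm
  rw [h]
  -- The existential over `g` hides closedness; in the distributional description both sides are
  -- continuous in `p`.
  have h' : IsClosed {p : L2 × L2 | Lp.toTemperedDistributionCLM ℂ volume 2 p.2 =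
      (-(1 / 2) : ℂ) • LineDeriv.laplacianCLM ℂ (EuclideanSpace ℝ (Fin 3)) _
        (Lp.toTemperedDistributionCLM ℂ volume 2 p.1)} :=
    isClosed_eq (by fun_prop) (by fun_prop)
  simp only [TemperedDistribution.laplacianCLM_apply, Lp.toTemperedDistributionCLM_apply] at h'
  exact h'

theorem isClosed_leftProdPairs :
    IsClosed (leftProdPairs : Set ((L2 →L[ℂ] L2) × (L2 →L[ℂ] L2))) := by
  have h : (leftProdPairs : Set ((L2 →L[ℂ] L2) × (L2 →L[ℂ] L2))) =
      {p | IsSelfAdjoint p.1} ∩ ⋂ f : L2,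
        (fun p : (L2 →L[ℂ] L2) × (L2 →L[ℂ] L2) => (p.1 f, p.2 f)) ⁻¹'
          {p : L2 × L2 | ∃ g, freeCutoff.Rel p.1 g ∧ freeCutoff.Rel g p.2} := by
    ext p
    simp [leftProdPairs, IsLeftProd]
  rw [h]
  exact (isClosed_isSelfAdjoint.preimage continuous_fst).inter
    (isClosed_iInter fun f => isClosed_rel_rel.preimage (by fun_prop))

theorem isRealBanachSpace_Z : IsRealBanachSpace Z normZ := by
  refine isRealBanachSpace_of_closed_graph isDominatingNorm_besselNorm sandwichPairs
    isClosed_sandwichPairs ?_ mem_Z_iff fun ρ τ h => normZ_eq h.2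
  intro τ h
  have hτ : IsSandwich 0 τ := h.2
  have h0 : IsSandwich 0 0 := fun _ _ _ => Cutoff.rel_zero
  exact toPMap_top_injective (hτ.closure_eq.symm.trans h0.closure_eq)

theorem isRealBanachSpace_Y : IsRealBanachSpace Y normY := by
  refine isRealBanachSpace_of_closed_graph isDominatingNorm_besselNorm leftProdPairs
    isClosed_leftProdPairs ?_ mem_Y_iff fun ρ γ h => normY_eq h.2
  intro γ h
  have hγ : IsLeftProd 0 γ := h.2
  have h0 : IsLeftProd 0 0 := fun _ => ⟨0, Cutoff.rel_zero, Cutoff.rel_zero⟩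
  exact toPMap_top_injective (hγ.leftProd_eq.symm.trans h0.leftProd_eq)

/-- `H₀ P n = (A n)²` is bounded, so `H₀ P n ρ P n` is a bounded operator times a trace class one.
-/
theorem compression_mem_Y {ρ : L2 →L[ℂ] L2} (hρ : IsSelfAdjoint ρ) (hρt : besselNorm ρ < ∞)
    (n : ℕ) : freeCutoff.P n ∘L ρ ∘L freeCutoff.P n ∈ Y := by
  have hfin : besselNorm (ρ ∘L freeCutoff.P n) < ∞ :=
    (besselNorm_comp_right_le (freeCutoff.norm_P_le n) ρ).trans_lt hρt
  exact (mem_Y_iff _).2 ⟨freeCutoff.A n ∘L freeCutoff.A n ∘L ρ ∘L freeCutoff.P n,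
    ⟨Cutoff.isSelfAdjoint_compression hρ n, fun _ => ⟨_, Cutoff.rel_P n _, Cutoff.rel_A n _⟩⟩,
    besselNorm_comp_left_lt_top _ hfin,
    besselNorm_comp_left_lt_top _ (besselNorm_comp_left_lt_top _ hfin)⟩

theorem exists_mem_Y_normZ_sub_lt {ρ : L2 →L[ℂ] L2} (hρ : ρ ∈ Z) {ε : ℝ} (hε : 0 < ε) :
    ∃ σ ∈ Y, normZ (ρ - σ) < ε := by
  obtain ⟨τ, ⟨h1, h2⟩, h3, h4⟩ := (mem_Z_iff ρ).1 hρ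
  have ht := (tendsto_besselNorm_sub_compression freeCutoff.norm_P_le freeCutoff.isSelfAdjoint_P
    freeCutoff.tendsto_P h3).add (tendsto_besselNorm_sub_compression freeCutoff.norm_P_le
    freeCutoff.isSelfAdjoint_P freeCutoff.tendsto_P h4)
  rw [add_zero] at ht
  obtain ⟨n, hn⟩ := (ht.eventually_lt_const (ENNReal.ofReal_pos.2 hε)).exists
  refine ⟨_, compression_mem_Y h1 h3 n, ?_⟩
  have hs : IsSandwich (ρ - freeCutoff.P n ∘L ρ ∘L freeCutoff.P n)
      (τ - freeCutoff.P n ∘L τ ∘L freeCutoff.P n) := by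
    intro f g hfg
    have := (h2 f g hfg).add ((Cutoff.rel_compression h2 n hfg).smul (-1))
    simpa [sub_eq_add_neg] using this
  rw [normZ_eq hs]
  exact ENNReal.toReal_lt_of_lt_ofReal hn

end Spaces

end HartreeFock

theorem mainTheorem6 :
    HartreeFock.IsRealBanachSpace HartreeFock.Z HartreeFock.normZ ∧
    HartreeFock.IsRealBanachSpace HartreeFock.Y HartreeFock.normY ∧
    HartreeFock.Y ⊆ HartreeFock.Z ∧
    ∀ ρ ∈ HartreeFock.Z, ∀ ε : ℝ, 0 < ε →
      ∃ σ ∈ HartreeFock.Y, HartreeFock.normZ (ρ - σ) < ε :=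
  ⟨HartreeFock.isRealBanachSpace_Z, HartreeFock.isRealBanachSpace_Y, HartreeFock.Y_subset_Z,
    fun _ hρ _ hε => HartreeFock.exists_mem_Y_normZ_sub_lt hρ hε⟩

end
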